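/- **Setting.** Let $m\ge 2$, let $\mathcal A=\{1,\dots,2m\}$, and put $\bar a=a+m$ for $a\le m$ and $\bar a=a-m$ for $a>m$. Fix Schottky data: open disks $D_1,\dots,D_{2m}\subset\mathbb C$ centred on $\mathbb R$ with mutually disjoint closures, and $\gamma_1,\dots,\gamma_{2m}\in\mathrm{PSL}_2(\mathbb R)$ with $\gamma_{\bar a}=\gamma_a^{-1}$ and $\gamma_a(\overline{\mathbb C}\smallsetminus D_{\bar a})=\overline{D_a}$ for all $a\in\mathcal A$, where $\overline{\mathbb C}=\mathbb C\cup\{\infty\}$ and $\overline{D_a}$ is the closure of $D_a$. Let $D=\bigcup_a D_a$, let $\Gamma$ be the group generated by the $\gamma_a$, let $\Lambda\subset\mathbb R$ be its limit set (the set of accumulation points of the $\Gamma$-orbits in the upper half-plane), and let $\delta$ be the Hausdorff dimension of $\Lambda$. For $h>0$ and $b\in\mathcal A$ put $\Omega_b(h)=\{z\in D_b:\ |z-p|<h\text{ for some }p\in\Lambda\}$. A word $\mathbf a=a_1\cdots a_n$ in $\mathcal A$ is reduced if $a_j\ne\overline{a_{j+1}}$ for all $j$; let $\mathcal W^\circ$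 be the set of non-empty reduced words. Put $\gamma_{\mathbf a}=\gamma_{a_1}\cdots\gamma_{a_n}$, and write $\mathbf a\to b$ if $a_n\ne\bar b$. For each $a\in\mathcal A$ choose a point $o_a\in D_a$, and for each $\mathbf a\in\mathcal W^\circ$ choose a letter $a$ with $\mathbf a\to a$ and put $o_{\mathbf a}=o_a$ and $\Upsilon_{\mathbf a}=|\gamma_{\mathbf a}'(o_{\mathbf a})|$. For $\mathbf a\ne\mathbf b$ in $\mathcal W^\circ$ let $$\Phi_{\mathbf a,\mathbf b}(z)=\log\gamma_{\mathbf a}'(z)-\log\gamma_{\mathbf b}'(z),\qquad \mathcal D_{\mathbf a,\mathbf b}=\left(\frac{\Upsilon_{\mathbf a}\Upsilon_{\mathbf b}}{\Upsilon_{\mathbf a\overline{\mathbf b}}}\right)^{1/2},$$ where $\log$ is the principal logarithm and $\mathbf a\overline{\mathbf b}$ denotes the (non-empty) reduced word that represents $\gamma_{\mathbf a}\gamma_{\mathbf b}^{-1}$. **Proposition (Key bound for averaged oscillatory integrals).** There are constants $C,T_0,h_0>0$ that depend only on the Schottky data, and for every $\epsilon>0$ a constant $K_\epsilon>0$ that depends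 only on the Schottky data and $\epsilon$, such that the following holds. For all choices of the points $o_a$ and of the letters defining $o_{\mathbf a}$, all $b\in\mathcal A$, all $\mathbf a,\mathbf b\in\mathcal W^\circ$ with $\mathbf a\to b$, $\mathbf b\to b$ and $\mathbf a\ne\mathbf b$, all $T\ge T_0$, all $h\in(0,h_0)$, and all measurable $f:D\to\mathbb C$ that are bounded on $D_b$, the integrals below exist and $$\frac1T\int_0^T\left|\int_{\Omega_b(h)}e^{it\Phi_{\mathbf a,\mathbf b}(z)}f(z)\,d\mathrm{vol}(z)\right|dt\ \le\ K_\epsilon\,h^{1-\frac\delta2}\,\mathcal D_{\mathbf a,\mathbf b}^{-1}\,T^{-1+\epsilon}\,e^{ChT}\,\sup_{z\in D_b}|f(z)|,$$ where $\mathrm{vol}$ is Lebesgue measure on $\mathbb C$. -/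

import Mathlib

open scoped Pointwise MatrixGroups

noncomputable section

namespace Schottky

/-- The alphabet `𝒜 = {1, …, 2m}`: the letter `(i, true)` is `i ∈ {1, …, m}` and `(i, false)` is
`i + m`. Words are lists of letters; a word is reduced when it is `FreeGroup.IsReduced`, that is,
when no letter is followed by its inverse letter. -/
abbrev Letter (m : ℕ) : Type := Fin m × Bool

/-- The involution `a ↦ ā` of the alphabet. -/
def bar {m : ℕ} (a : Letter m) : Letter m := (a.1, !a.2)

/-- The Möbius transformation `z ↦ (αz + β) / (γz + δ)` on `ℂ` (away from its pole). -/
def mobius (g : SL(2, ℝ)) (z : ℂ) : ℂ :=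
  ((g 0 0 : ℂ) * z + (g 0 1 : ℂ)) / ((g 1 0 : ℂ) * z + (g 1 1 : ℂ))

/-- `w → b`: the word `w` is empty or its last letter is not `b̄`. -/
def Follows {m : ℕ} (w : List (Letter m)) (b : Letter m) : Prop :=
  ∀ x ∈ w.getLast?, x ≠ bar b

/-- The isometry attached to a letter, where `g i` is attached to the letter `i ∈ {1, …, m}` and
the inverse of `g i` to the letter `i + m`. -/
def letterMap {m : ℕ} (g : Fin m → SL(2, ℝ)) (a : Letter m) : SL(2, ℝ) :=
  if a.2 then g a.1 else (g a.1)⁻¹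

/-- Schottky data of rank `m`: open disks `D_a ⊆ ℂ` centred on the real line with mutually
disjoint closures, and isometries `γ_a` with `γ_ā = γ_a⁻¹` that map the complement of `D_ā` in the
Riemann sphere onto the closure of `D_a`. The isometries are given by representatives in
`SL(2, ℝ)`; the sphere is `OnePoint ℂ` with Mathlib's action of `GL(2, ℂ)`. -/
structure Data (m : ℕ) where
  center : Letter m → ℝ
  radius : Letter m → ℝ
  radius_pos : ∀ a, 0 < radius a
  disjoint_closedBall : ∀ a b, a ≠ b →
    Disjoint (Metric.closedBall (center a : ℂ) (radius a))
      (Metric.closedBall (center b : ℂ) (radius b))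
  gen : Fin m → SL(2, ℝ)
  image_compl : ∀ a,
    (fun x : OnePoint ℂ => Matrix.SpecialLinearGroup.mapGL ℂ (letterMap gen a) • x) ''
        ((fun z : ℂ => (z : OnePoint ℂ)) ''
          Metric.ball (center (bar a) : ℂ) (radius (bar a)))ᶜ =
      (fun z : ℂ => (z : OnePoint ℂ)) '' Metric.closedBall (center a : ℂ) (radius a)

namespace Data

variable {m : ℕ} (S : Data m)

/-- The open disk `D_a`. -/
def disk (a : Letter m) : Set ℂ := Metric.ball (S.center a : ℂ) (S.radius a)

/-- The union `D` of all the disks `D_a`. -/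
def disks : Set ℂ := ⋃ a, S.disk a

/-- `γ_w = γ_{a₁} ⋯ γ_{aₙ}` for a word `w = a₁ … aₙ`. -/
def wordMap (w : List (Letter m)) : SL(2, ℝ) := (w.map (letterMap S.gen)).prod

/-- The derivative `γ_w'(z)`. -/
def wordDeriv (w : List (Letter m)) (z : ℂ) : ℂ := deriv (mobius (S.wordMap w)) z

/-- The Schottky group `Γ` generated by the isometries `γ_a`. -/
def group : Subgroup SL(2, ℝ) := Subgroup.closure (Set.range (letterMap S.gen))

/-- The limit set `Λ` of `Γ`: the accumulation points in `ℂ` of the orbits of `Γ` on the upper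
half-plane. (The point `∞` has a neighbourhood in the sphere that contains at most finitely many
points of each orbit, so that no limit point is lost.) -/
def limitSet : Set ℂ :=
  {p | ∃ z : UpperHalfPlane,
    AccPt p (Filter.principal (Set.range fun g : S.group => (((g : SL(2, ℝ)) • z : UpperHalfPlane) : ℂ)))}

/-- The Hausdorff dimension `δ` of the limit set. -/
def delta : ℝ := (dimH S.limitSet).toReal

/-- `Ω_b(h) = (Λ + D_ℂ(0, h)) ∩ D_b`. -/
def omega (b : Letter m) (h : ℝ) : Set ℂ := (S.limitSet + Metric.ball (0 : ℂ) h) ∩ S.disk b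

/-- The phase `Φ_{u,v}(z) = log γ_u'(z) - log γ_v'(z)`, with the principal logarithm. -/
def phase (u v : List (Letter m)) (z : ℂ) : ℂ :=
  Complex.log (S.wordDeriv u z) - Complex.log (S.wordDeriv v z)

/-- A choice of reference points: a point `o_a ∈ D_a` for each letter `a`, and for each non-empty
reduced word `w` a letter `a` with `w → a`, which gives `o_w = o_a`. -/
structure RefPoints where
  point : Letter m → ℂ
  point_mem : ∀ a, point a ∈ S.disk a
  next : List (Letter m) → Letter m
  follows_next : ∀ w, FreeGroup.IsReduced w → w ≠ [] → Follows w (next w)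

variable {S}

/-- `Υ_w = |γ_w'(o_w)|`. -/
def RefPoints.upsilon (P : S.RefPoints) (w : List (Letter m)) : ℝ :=
  ‖S.wordDeriv w (P.point (P.next w))‖

/-- `𝒟_{u,v} = (Υ_u Υ_v / Υ_{u v̄})^{1/2}`, where `v̄` is the mirror word, so that
`γ_v̄ = γ_v⁻¹`, and `u v̄` is the reduced word that represents `γ_u γ_v⁻¹`. -/
def RefPoints.scriptD (P : S.RefPoints) (u v : List (Letter m)) : ℝ :=
  Real.sqrt (P.upsilon u * P.upsilon v /
    P.upsilon (FreeGroup.reduce (u ++ FreeGroup.invRev v)))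

end Data

end Schottky

end

/-!
The proof is an `L²` argument whose geometric input is explicit, because every `γ_w` is a Möbius
transformation.

*Mean value.* By Cauchy–Schwarz in `t`, the mean of `|∫ e^{itΦ} f|` is controlled by its mean
square. Opening the square and integrating in `t` first turns `∫₀ᵀ |∫ e^{itΦ} f|² dt` into a double
integral over `Ω_b(h)` of `(e^{iTθ} - 1) / (iθ)` with `θ = Φ(z) - conj Φ(w)`. As `|Im Φ| ≪ h` on
`Ω_b(h)`, this costs a factor `e^{ChT}` and leaves the area of `Ω_b(h)` times the energy
`sup_z ∫ |Φ(z) - conj Φ(w)|⁻¹ dw` (`integral_norm_oscillatory_le`).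

*Phase.* If `c` is the lower left entry and `x_w` the pole of `γ_w`, then `γ_w'(z) = (c (z - x_w))⁻²`,
and ping-pong puts `x_w` in the closed disk of the inverse of the last letter of `w`, at a distance
bounded below from each disk that may follow `w`. The exponential of `-(Φ(z) - Φ(w)) / 2` is the
cross ratio of `z`, `w` and the two poles, so that `|Φ(z) - Φ(w)| ≫ |x_u - x_v| |z - w|`
(`Bounds.le_norm_phase_sub`).
Moreover `𝒟_{u,v} ≪ |x_u - x_v|`, because the lower left entry of `γ_u γ_v⁻¹` is the product of those of
`γ_u` and `γ_v` times `x_u - x_v` (`Bounds.scriptD_le`). Since `Ω_b(h)` lies in the strip `|Im z| ≤ h`, the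
energy is `≪ h^{1-τ} 𝒟⁻¹` for every `τ > 0` (`Bounds.energy_le`). Compared with the claim, a power
of `hT` and the factor `T^{τ/2}` are left over; `e^{hT}` and `T^ε` absorb them.

*Area.* That `Ω_b(h)` has area `≪ h^{2-δ}` amounts to the bound `≪ h^{-δ}` for the cardinality of
`h`-separated subsets of `Λ`, with `δ` exactly the Hausdorff dimension. This follows an argument of
Falconer for quasi-self-similar sets. Each limit point `p` lies in a closed disk `γ_w(D̄_x)` of size
comparable with `h`. Near each of `N` separated points for which `w` starts with the same letter `a`
there is a copy of `D̄_a` under an element of `Γ`, contracted by a factor comparable with `h`. These `N`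
contractions generate an attractor inside `Λ`, whose dimension is at least `log N / log (1 / κh)`
for a constant `κ`, since base `N` coding maps it onto `[0, 1]` by a Hölder map (`natCast_le_rpow_neg_of_dimH_le`,
`exists_card_separated_le`). Words of the required contraction exist because only finitely many
words have bounded lower left entry (`Bounds.finite_lower_left_le`).
-/

/-! ### Dimension of attractors -/

/-- The composition `ψ_{s 0} ∘ ψ_{s 1} ∘ ⋯ ∘ ψ_{s (k-1)}` of the first `k` maps that a sequence `s`
selects from a family. -/
def iterComp {X ι : Type*} (ψ : ι → X → X) (s : ℕ → ι) : ℕ → X → X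
  | 0 => id
  | k + 1 => iterComp ψ s k ∘ ψ (s k)

section IterComp

variable {X ι : Type*} {ψ : ι → X → X} {F : Set X}

lemma iterComp_congr {s s' : ℕ → ι} {k : ℕ} (h : ∀ j < k, s j = s' j) :
    iterComp ψ s k = iterComp ψ s' k := by
  induction k with
  | zero => rfl
  | succ k ih =>
    simp only [iterComp]
    rw [ih fun j hj => h j (by omega), h k (by omega)]

lemma iterComp_image_antitone (hF : ∀ i, Set.MapsTo (ψ i) F F) (s : ℕ → ι) (k : ℕ) :
    iterComp ψ s (k + 1) '' F ⊆ iterComp ψ s k '' F := by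
  rintro _ ⟨x, hx, rfl⟩
  exact ⟨ψ (s k) x, hF _ hx, rfl⟩

variable [MetricSpace X]

lemma iterComp_continuousOn (hF : ∀ i, Set.MapsTo (ψ i) F F) (hc : ∀ i, ContinuousOn (ψ i) F)
    (s : ℕ → ι) (k : ℕ) : ContinuousOn (iterComp ψ s k) F := by
  induction k with
  | zero => exact continuousOn_id
  | succ k ih => exact ih.comp (hc _) (hF _)

lemma pow_mul_dist_le_dist_iterComp (hF : ∀ i, Set.MapsTo (ψ i) F F) {c : ℝ} (hc : 0 < c)
    (hexp : ∀ i, ∀ x ∈ F, ∀ y ∈ F, c * dist x y ≤ dist (ψ i x) (ψ i y))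
    (s : ℕ → ι) (k : ℕ) {x y : X} (hx : x ∈ F) (hy : y ∈ F) :
    c ^ k * dist x y ≤ dist (iterComp ψ s k x) (iterComp ψ s k y) := by
  induction k generalizing x y with
  | zero => simp [iterComp]
  | succ k ih =>
    calc c ^ (k + 1) * dist x y = c ^ k * (c * dist x y) := by ring
      _ ≤ c ^ k * dist (ψ (s k) x) (ψ (s k) y) := by gcongr; exact hexp _ x hx y hy
      _ ≤ _ := ih (hF _ hx) (hF _ hy)

/-- Points whose codes agree up to `k` and differ at `k` are at distance at least `c ^ k * η`. -/
lemma pow_mul_le_dist_of_codes_ne (hF : ∀ i, Set.MapsTo (ψ i) F F) {c η : ℝ} (hc : 0 < c)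
    (hexp : ∀ i, ∀ x ∈ F, ∀ y ∈ F, c * dist x y ≤ dist (ψ i x) (ψ i y))
    (hsep : ∀ i j, i ≠ j → ∀ x ∈ F, ∀ y ∈ F, η ≤ dist (ψ i x) (ψ j y))
    {s s' : ℕ → ι} {k : ℕ} (h : ∀ j < k, s j = s' j) (hk : s k ≠ s' k) {p q : X}
    (hp : p ∈ iterComp ψ s (k + 1) '' F) (hq : q ∈ iterComp ψ s' (k + 1) '' F) :
    c ^ k * η ≤ dist p q := by
  obtain ⟨x, hx, rfl⟩ := hp
  obtain ⟨y, hy, rfl⟩ := hq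
  simp only [iterComp, Function.comp]
  rw [← iterComp_congr h]
  refine le_trans ?_ (pow_mul_dist_le_dist_iterComp hF hc hexp s k (hF _ hx) (hF _ hy))
  gcongr
  exact hsep _ _ hk x hx y hy

/-- If `N` maps of a compact set `F` into itself have `η`-separated images and shrink distances
at most by the factor `c`, then `N` is at most `c ^ (-δ)` for every upper bound `δ` of the
Hausdorff dimension of a set that contains the attractor. The reason: with `N = c ^ (-t)`, the map
that reads the code of a point of the attractor as the digits of a real number in base `N` is
`t`-Hölder and takes every value in `[0, 1]`. -/
theorem natCast_le_rpow_neg_of_dimH_le (hF : ∀ i, Set.MapsTo (ψ i) F F) (hFc : IsCompact F)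
    (hFn : F.Nonempty) [Fintype ι] (hcont : ∀ i, ContinuousOn (ψ i) F) {c η δ : ℝ} (hc : 0 < c)
    (hc1 : c < 1) (hη : 0 < η)
    (hexp : ∀ i, ∀ x ∈ F, ∀ y ∈ F, c * dist x y ≤ dist (ψ i x) (ψ i y))
    (hsep : ∀ i j, i ≠ j → ∀ x ∈ F, ∀ y ∈ F, η ≤ dist (ψ i x) (ψ j y))
    {E : Set X} (hE : ∀ (s : ℕ → ι) (p : X), (∀ k, p ∈ iterComp ψ s k '' F) → p ∈ E)
    (hδ : 0 ≤ δ) (hdim : dimH E ≤ ENNReal.ofReal δ) :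
    (Fintype.card ι : ℝ) ≤ c ^ (-δ) := by
  rcases Nat.lt_or_ge 1 (Fintype.card ι) with hN | hN
  swap
  · exact (show (Fintype.card ι : ℝ) ≤ 1 by exact_mod_cast hN).trans
      (Real.one_le_rpow_of_pos_of_le_one_of_nonpos hc hc1.le (by linarith))
  set N := Fintype.card ι with hNdef
  have hN0 : (0 : ℝ) < N := by positivity
  have hN1 : (1 : ℝ) < N := by exact_mod_cast hN
  let e : ι ≃ Fin N := Fintype.equivFin ι
  set t : ℝ := Real.log N / (-Real.log c) with ht
  have hlc : 0 < -Real.log c := by linarith [Real.log_neg hc hc1]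
  have ht0 : 0 < t := div_pos (Real.log_pos hN1) hlc
  have hNt : (N : ℝ)⁻¹ = c ^ t := by
    rw [Real.rpow_def_of_pos hc, ← Real.exp_log hN0, ← Real.exp_neg, ht]
    congr 1
    have hlc' : Real.log c ≠ 0 := by intro h; simp [h] at hlc
    field_simp
  set A : Set X := {p | ∃ s : ℕ → ι, ∀ k, p ∈ iterComp ψ s k '' F} with hA
  have hAE : A ⊆ E := fun p ⟨s, hs⟩ => hE s p hs
  have : Nonempty ι := Fintype.card_pos_iff.1 (by omega)
  choose! code hcode using fun (p : X) (hp : p ∈ A) => hp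
  let f : X → ℝ := fun p => Real.ofDigits fun k => e (code p k)
  have key : ∀ {s s' : ℕ → ι}, s ≠ s' → ∃ k, (∀ j < k, s j = s' j) ∧ s k ≠ s' k := by
    intro s s' h
    have hex : ∃ k, s k ≠ s' k := by
      by_contra hcon
      push Not at hcon
      exact h (funext hcon)
    classical
    exact ⟨Nat.find hex, fun j hj => not_not.1 (Nat.find_min hex hj), Nat.find_spec hex⟩
  have huniq : ∀ (s : ℕ → ι) (p : X), (∀ k, p ∈ iterComp ψ s k '' F) → code p = s := by
    intro s p hs
    by_contra hne
    obtain ⟨k, hk, hk'⟩ := key hne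
    have := pow_mul_le_dist_of_codes_ne hF hc hexp hsep hk hk' (hcode p ⟨s, hs⟩ (k + 1)) (hs (k + 1))
    rw [dist_self] at this
    have : 0 < c ^ k * η := by positivity
    linarith
  have hholder : HolderOnWith (Real.toNNReal (η ^ (-t))) (Real.toNNReal t) f A := by
    intro p hp q hq
    have hreal : dist (f p) (f q) ≤ η ^ (-t) * dist p q ^ t := by
      by_cases hpq : code p = code q
      · have : f p = f q := by simp only [f, hpq]
        rw [this, dist_self]; positivity
      obtain ⟨k, hk, hk'⟩ := key hpq
      have h1 := pow_mul_le_dist_of_codes_ne hF hc hexp hsep hk hk' (hcode p hp (k + 1))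
        (hcode q hq (k + 1))
      have h2 : dist (f p) (f q) ≤ ((N : ℝ) ^ k)⁻¹ := by
        rw [Real.dist_eq]
        have := Real.abs_ofDigits_sub_ofDigits_le (b := N) (x := fun k => e (code p k))
          (y := fun k => e (code q k)) (n := k) (fun i hi => by simp [hk i hi])
        simpa [f] using this
      have h3 : ((N : ℝ) ^ k)⁻¹ = (c ^ k) ^ t := by
        rw [← inv_pow, hNt, ← Real.rpow_natCast, ← Real.rpow_mul hc.le, ← Real.rpow_natCast,
          ← Real.rpow_mul hc.le, mul_comm]
      calc dist (f p) (f q) ≤ (c ^ k) ^ t := h2.trans h3.le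
        _ = η ^ (-t) * (c ^ k * η) ^ t := by
            rw [Real.mul_rpow (by positivity) hη.le, Real.rpow_neg hη.le]
            field_simp
        _ ≤ η ^ (-t) * dist p q ^ t := by gcongr
    rw [edist_dist, edist_dist, Real.coe_toNNReal t ht0.le, ENNReal.ofReal_rpow_of_nonneg
      dist_nonneg ht0.le]
    refine (ENNReal.ofReal_le_ofReal hreal).trans ?_
    rw [ENNReal.ofReal_mul (by positivity)]
    rfl
  have hsurj : Set.Icc (0 : ℝ) 1 ⊆ f '' A := by
    intro x hx
    obtain ⟨d, -, hd⟩ := Real.ofDigits_SurjOn hN hx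
    set s : ℕ → ι := fun k => e.symm (d k) with hs
    have : (⋂ k, iterComp ψ s k '' F).Nonempty := by
      apply IsCompact.nonempty_iInter_of_sequence_nonempty_isCompact_isClosed
      · exact iterComp_image_antitone hF s
      · exact fun k => hFn.image _
      · simpa [iterComp] using hFc
      · exact fun k => (hFc.image_of_continuousOn (iterComp_continuousOn hF hcont s k)).isClosed
    obtain ⟨p, hp⟩ := this
    have hp' : ∀ k, p ∈ iterComp ψ s k '' F := Set.mem_iInter.1 hp
    refine ⟨p, ⟨s, hp'⟩, ?_⟩
    simp only [f, huniq s p hp', hs, Equiv.apply_symm_apply]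
    exact hd
  have h1 : (1 : ENNReal) ≤ dimH E / (Real.toNNReal t : ENNReal) := by
    have hI : dimH (Set.Icc (0 : ℝ) 1) = 1 := by
      rw [Real.dimH_of_nonempty_interior (by simp [interior_Icc])]
      simp
    calc (1 : ENNReal) = dimH (Set.Icc (0 : ℝ) 1) := hI.symm
      _ ≤ dimH (f '' A) := dimH_mono hsurj
      _ ≤ dimH A / (Real.toNNReal t : ENNReal) :=
          hholder.dimH_image_le (Real.toNNReal_pos.2 ht0)
      _ ≤ _ := by gcongr
  have h2 : t ≤ δ := by
    have h3 := ENNReal.mul_le_of_le_div h1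
    rw [one_mul] at h3
    exact (ENNReal.ofReal_le_ofReal_iff hδ).1 (h3.trans hdim)
  calc (N : ℝ) = c ^ (-t) := by rw [Real.rpow_neg hc.le, ← hNt, inv_inv]
    _ ≤ c ^ (-δ) := Real.rpow_le_rpow_of_exponent_ge hc hc1.le (by linarith)

end IterComp

/-! ### Mean values of oscillatory integrals -/

open MeasureTheory in
/-- Cauchy–Schwarz against the constant function `1` on `[0, T]`. -/
lemma integral_le_sqrt_mul_integral_sq {g : ℝ → ℝ} {T : ℝ} (hT : 0 < T)
    (hg : IntegrableOn g (Set.Ioc 0 T)) (hg2 : IntegrableOn (fun t => g t ^ 2) (Set.Ioc 0 T)) :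
    ∫ t in Set.Ioc 0 T, g t ≤ Real.sqrt (T * ∫ t in Set.Ioc 0 T, g t ^ 2) := by
  apply Real.le_sqrt_of_sq_le
  set A := ∫ t in Set.Ioc 0 T, g t with hA
  -- The square of the deviation of `g` from its mean `A / T` has non-negative integral.
  have h0 : 0 ≤ ∫ t in Set.Ioc 0 T, (g t - A / T) ^ 2 := integral_nonneg fun t => sq_nonneg _
  have h1 : ∫ t in Set.Ioc 0 T, (g t - A / T) ^ 2
      = (∫ t in Set.Ioc 0 T, g t ^ 2) - 2 * (A / T) * A + T * (A / T) ^ 2 := by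
    have hc : IntegrableOn (fun _ : ℝ => (A / T) ^ 2) (Set.Ioc 0 T) := by simp
    calc ∫ t in Set.Ioc 0 T, (g t - A / T) ^ 2
        = ∫ t in Set.Ioc 0 T, (g t ^ 2 - 2 * (A / T) * g t + (A / T) ^ 2) := by
          congr 1; ext t; ring
      _ = _ := by
          have hs : IntegrableOn (fun t => g t ^ 2 - 2 * (A / T) * g t) (Set.Ioc 0 T) :=
            hg2.sub (hg.const_mul _)
          rw [integral_add hs hc, integral_sub hg2 (hg.const_mul _),
            integral_const_mul]
          simp [hT.le, ← hA]
  have h2 : 2 * (A / T) * A - T * (A / T) ^ 2 = A ^ 2 / T := by field_simp; ring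
  have h3 : A ^ 2 / T ≤ ∫ t in Set.Ioc 0 T, g t ^ 2 := by linarith
  rw [div_le_iff₀ hT] at h3
  linarith

open MeasureTheory in
/-- Exact integration of an exponential with complex frequency `θ`. For `θ = 0` the right-hand
side is infinite. -/
lemma enorm_integral_exp_le {θ : ℂ} {κ T : ℝ} (hT : 0 < T) (hκ : 0 ≤ κ) (hθ : |θ.im| ≤ κ) :
    ‖∫ t in Set.Ioc 0 T, Complex.exp (Complex.I * t * θ)‖ₑ ≤
      ENNReal.ofReal (2 * Real.exp (κ * T)) * ‖θ‖ₑ⁻¹ := by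
  rcases eq_or_ne θ 0 with rfl | h0
  · simp
    rw [ENNReal.mul_top (by simp; positivity)]
    exact le_top
  have hn : 0 < ‖θ‖ := norm_pos_iff.2 h0
  rw [← intervalIntegral.integral_of_le hT.le]
  have h1 : ∫ t in (0 : ℝ)..T, Complex.exp (Complex.I * t * θ)
      = (Complex.exp (Complex.I * θ * T) - Complex.exp (Complex.I * θ * (0 : ℝ))) /
        (Complex.I * θ) := by
    rw [← integral_exp_mul_complex (by simp [h0])]
    congr 1; ext t; ring_nf
  have h2 : ‖Complex.exp (Complex.I * θ * T)‖ ≤ Real.exp (κ * T) := by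
    rw [Complex.norm_exp]
    apply Real.exp_le_exp.2
    have : (Complex.I * θ * T).re = -θ.im * T := by simp
    rw [this]
    have := neg_abs_le θ.im
    gcongr; linarith
  have h3 : (1 : ℝ) ≤ Real.exp (κ * T) := Real.one_le_exp (by positivity)
  rw [h1, ← ofReal_norm, ← ofReal_norm, ← ENNReal.ofReal_inv_of_pos hn,
    ← ENNReal.ofReal_mul (by positivity)]
  apply ENNReal.ofReal_le_ofReal
  rw [norm_div, norm_mul, Complex.norm_I, one_mul, div_eq_mul_inv]
  gcongr
  refine (norm_sub_le _ _).trans ?_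
  simp only [Complex.ofReal_zero, mul_zero, Complex.exp_zero, norm_one]
  linarith

open MeasureTheory ComplexConjugate in
/-- The mean over `t ∈ [0, T]` of the oscillatory integral `∫ e^{itΨ} f dμ` is controlled by the
energy `∫ |Ψ(z) - conj Ψ(w)|⁻¹ dμ(w)`: after Cauchy–Schwarz, the square is opened and the `t`
integral is done first. -/
theorem integral_norm_oscillatory_le {α : Type*} [MeasurableSpace α] (μ : Measure α)
    [IsFiniteMeasure μ] {Ψ f : α → ℂ} (hΨ : Measurable Ψ) (hf : Measurable f) {B κ T J : ℝ}
    (hB : ∀ z, ‖f z‖ ≤ B) (hB0 : 0 ≤ B) (hκ0 : 0 ≤ κ) (hκ : ∀ z, |(Ψ z).im| ≤ κ) (hT : 0 < T)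
    (hJ0 : 0 ≤ J) (hJ : ∀ᵐ z ∂μ, ∫⁻ w, ‖Ψ z - conj (Ψ w)‖ₑ⁻¹ ∂μ ≤ ENNReal.ofReal J) :
    (∀ t : ℝ, Integrable (fun z => Complex.exp (Complex.I * t * Ψ z) * f z) μ) ∧
    IntervalIntegrable (fun t : ℝ => ‖∫ z, Complex.exp (Complex.I * t * Ψ z) * f z ∂μ‖)
      volume 0 T ∧
    ∫ t in (0 : ℝ)..T, ‖∫ z, Complex.exp (Complex.I * t * Ψ z) * f z ∂μ‖ ≤
      Real.sqrt (T * (2 * B ^ 2 * Real.exp (2 * κ * T) * μ.real Set.univ * J)) := by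
  set F : ℝ × α → ℂ := fun q => Complex.exp (Complex.I * q.1 * Ψ q.2) * f q.2 with hF
  have hFm : Measurable F := by fun_prop
  have hFb : ∀ t z, ‖F (t, z)‖ ≤ Real.exp (κ * |t|) * B := by
    intro t z
    simp only [hF, norm_mul, Complex.norm_exp]
    have : (Complex.I * (t : ℂ) * Ψ z).re = -t * (Ψ z).im := by simp
    rw [this]
    have h1 : -t * (Ψ z).im ≤ κ * |t| := by
      calc -t * (Ψ z).im ≤ |-t * (Ψ z).im| := le_abs_self _
        _ = |(Ψ z).im| * |t| := by rw [abs_mul, abs_neg, mul_comm]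
        _ ≤ κ * |t| := by gcongr; exact hκ z
    gcongr
    exact hB z
  have hFi : ∀ t, Integrable (fun z => F (t, z)) μ := fun t =>
    Integrable.of_bound (hFm.comp (by fun_prop)).aestronglyMeasurable _
      (Filter.Eventually.of_forall (hFb t))
  set G : ℝ → ℂ := fun t => ∫ z, F (t, z) ∂μ with hG
  have hGm : StronglyMeasurable G := hFm.stronglyMeasurable.integral_prod_right'
  set ν := (volume : Measure ℝ).restrict (Set.Ioc 0 T) with hν
  have habs : ∀ᵐ t ∂ν, |t| ≤ T := by
    refine (ae_restrict_mem measurableSet_Ioc).mono fun t ht => ?_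
    rw [abs_of_pos ht.1]; exact ht.2
  set L := Real.exp (κ * T) * B with hL
  have hL0 : 0 ≤ L := by positivity
  have hFL : ∀ t, |t| ≤ T → ∀ z, ‖F (t, z)‖ ≤ L := by
    intro t ht z
    refine (hFb t z).trans ?_
    simp only [hL]; gcongr
  have hGb : ∀ᵐ t ∂ν, ‖G t‖ ≤ L * μ.real Set.univ := by
    filter_upwards [habs] with t ht
    exact norm_integral_le_of_norm_le_const (Filter.Eventually.of_forall (hFL t ht))
  have hGi : Integrable (fun t => ‖G t‖) ν :=
    (Integrable.of_bound hGm.aestronglyMeasurable _ hGb).norm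
  have hG2i : Integrable (fun t => ‖G t‖ ^ 2) ν := by
    refine Integrable.of_bound (hGm.norm.pow 2).aestronglyMeasurable
      ((L * μ.real Set.univ) ^ 2) ?_
    filter_upwards [hGb] with t ht
    rw [Real.norm_of_nonneg (by positivity)]
    gcongr
  refine ⟨hFi, (intervalIntegrable_iff_integrableOn_Ioc_of_le hT.le).2 hGi, ?_⟩
  rw [intervalIntegral.integral_of_le hT.le]
  refine (integral_le_sqrt_mul_integral_sq hT hGi hG2i).trans ?_
  apply Real.sqrt_le_sqrt
  gcongr
  -- Open the square as a double integral and integrate in `t` first.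
  set H : ℝ × (α × α) → ℂ := fun q => F (q.1, q.2.1) * conj (F (q.1, q.2.2)) with hH
  have hHm : Measurable H := by
    have h1 : Measurable fun q : ℝ × (α × α) => F (q.1, q.2.1) := hFm.comp (by fun_prop)
    have h2 : Measurable fun q : ℝ × (α × α) => F (q.1, q.2.2) := hFm.comp (by fun_prop)
    exact h1.mul (Complex.continuous_conj.measurable.comp h2)
  have hHi : Integrable H (ν.prod (μ.prod μ)) := by
    refine Integrable.of_bound hHm.aestronglyMeasurable (L * L) ?_
    filter_upwards [Measure.quasiMeasurePreserving_fst.ae habs] with q hq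
    simp only [hH, norm_mul, RCLike.norm_conj]
    exact mul_le_mul (hFL _ hq _) (hFL _ hq _) (norm_nonneg _) hL0
  have hGH : ∀ t, ((‖G t‖ ^ 2 : ℝ) : ℂ) = ∫ p, H (t, p) ∂(μ.prod μ) := by
    intro t
    simp only [hH, hG]
    rw [integral_prod_mul (fun z => F (t, z)) (fun w => conj (F (t, w))), integral_conj,
      Complex.mul_conj, Complex.normSq_eq_norm_sq]
  have hswap : ((∫ t, ‖G t‖ ^ 2 ∂ν : ℝ) : ℂ) = ∫ p, ∫ t, H (t, p) ∂ν ∂(μ.prod μ) := by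
    rw [← integral_complex_ofReal]
    simp_rw [hGH]
    exact integral_integral_swap hHi
  have hinner : ∀ p : α × α, ‖∫ t, H (t, p) ∂ν‖ₑ ≤
      ENNReal.ofReal (2 * B ^ 2 * Real.exp (2 * κ * T)) * ‖Ψ p.1 - conj (Ψ p.2)‖ₑ⁻¹ := by
    rintro ⟨z, w⟩
    have h1 : ∀ t : ℝ, H (t, (z, w)) =
        Complex.exp (Complex.I * t * (Ψ z - conj (Ψ w))) * (f z * conj (f w)) := by
      intro t
      simp only [hH, hF, map_mul, ← Complex.exp_conj, Complex.conj_I, Complex.conj_ofReal]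
      rw [mul_mul_mul_comm, ← Complex.exp_add]
      congr 2; ring
    simp_rw [h1]
    rw [integral_mul_const, enorm_mul]
    have h2 : ‖f z * conj (f w)‖ₑ ≤ ENNReal.ofReal (B ^ 2) := by
      rw [← ofReal_norm, norm_mul, RCLike.norm_conj]
      apply ENNReal.ofReal_le_ofReal
      rw [sq]
      exact mul_le_mul (hB z) (hB w) (norm_nonneg _) hB0
    have h3 := enorm_integral_exp_le (θ := Ψ z - conj (Ψ w)) hT (κ := 2 * κ) (by positivity) (by
      simp only [Complex.sub_im, Complex.conj_im, sub_neg_eq_add]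
      exact (abs_add_le _ _).trans (by linarith [hκ z, hκ w]))
    calc _ ≤ (ENNReal.ofReal (2 * Real.exp (2 * κ * T)) * ‖Ψ z - conj (Ψ w)‖ₑ⁻¹) *
          ENNReal.ofReal (B ^ 2) := mul_le_mul' h3 h2
      _ = _ := by
          rw [mul_right_comm, ← ENNReal.ofReal_mul (by positivity)]
          congr 2; ring
  have hmain : ENNReal.ofReal (∫ t, ‖G t‖ ^ 2 ∂ν) ≤
      ENNReal.ofReal (2 * B ^ 2 * Real.exp (2 * κ * T) * μ.real Set.univ * J) := by
    have hnn : 0 ≤ ∫ t, ‖G t‖ ^ 2 ∂ν := integral_nonneg fun t => by positivity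
    have hdm : Measurable fun p : α × α => ‖Ψ p.1 - conj (Ψ p.2)‖ₑ⁻¹ := by
      have h1 : Measurable fun p : α × α => conj (Ψ p.2) :=
        Complex.continuous_conj.measurable.comp (by fun_prop)
      have h2 : Measurable fun p : α × α => Ψ p.1 - conj (Ψ p.2) :=
        (hΨ.comp measurable_fst).sub h1
      exact h2.enorm.inv
    calc ENNReal.ofReal (∫ t, ‖G t‖ ^ 2 ∂ν)
        = ‖((∫ t, ‖G t‖ ^ 2 ∂ν : ℝ) : ℂ)‖ₑ := by
          rw [← ofReal_norm, Complex.norm_real, Real.norm_of_nonneg hnn]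
      _ ≤ ∫⁻ p, ‖∫ t, H (t, p) ∂ν‖ₑ ∂(μ.prod μ) := by
          rw [hswap]; exact enorm_integral_le_lintegral_enorm _
      _ ≤ ∫⁻ p, ENNReal.ofReal (2 * B ^ 2 * Real.exp (2 * κ * T)) *
            ‖Ψ p.1 - conj (Ψ p.2)‖ₑ⁻¹ ∂(μ.prod μ) := lintegral_mono hinner
      _ = ENNReal.ofReal (2 * B ^ 2 * Real.exp (2 * κ * T)) *
            ∫⁻ z, ∫⁻ w, ‖Ψ z - conj (Ψ w)‖ₑ⁻¹ ∂μ ∂μ := by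
          rw [lintegral_const_mul _ hdm, lintegral_prod _ hdm.aemeasurable]
      _ ≤ ENNReal.ofReal (2 * B ^ 2 * Real.exp (2 * κ * T)) *
            ∫⁻ _, ENNReal.ofReal J ∂μ := by
          gcongr 1
          exact lintegral_mono_ae hJ
      _ = _ := by
          rw [lintegral_const, ← ofReal_measureReal, mul_comm (ENNReal.ofReal J),
            ← ENNReal.ofReal_mul (by positivity), ← ENNReal.ofReal_mul (by positivity)]
          congr 1; ring
  exact (ENNReal.ofReal_le_ofReal_iff (by positivity)).1 hmain

/-! ### Möbius transformations, words and ping-pong -/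

namespace Schottky

/-- The denominator `γz + δ` of a Möbius transformation. -/
noncomputable def den (g : SL(2, ℝ)) (z : ℂ) : ℂ := (g 1 0 : ℂ) * z + (g 1 1 : ℂ)

lemma mobius_def (g : SL(2, ℝ)) (z : ℂ) :
    mobius g z = ((g 0 0 : ℂ) * z + (g 0 1 : ℂ)) / den g z := rfl

lemma det_eq (g : SL(2, ℝ)) : g 0 0 * g 1 1 - g 0 1 * g 1 0 = 1 := by
  have := g.det_coe
  rwa [Matrix.det_fin_two] at this

lemma mul_apply_two (g h : SL(2, ℝ)) (i j : Fin 2) :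
    (g * h) i j = g i 0 * h 0 j + g i 1 * h 1 j := by
  simp [Matrix.mul_apply, Fin.sum_univ_two]

lemma inv_apply_zero_zero (g : SL(2, ℝ)) : g⁻¹ 0 0 = g 1 1 := by
  simp [Matrix.SpecialLinearGroup.SL2_inv_expl]

lemma inv_apply_one_zero (g : SL(2, ℝ)) : g⁻¹ 1 0 = -g 1 0 := by
  simp [Matrix.SpecialLinearGroup.SL2_inv_expl]

lemma den_mul {g h : SL(2, ℝ)} {z : ℂ} (hz : den h z ≠ 0) :
    den (g * h) z = den g (mobius h z) * den h z := by
  rw [den, den, mobius_def, add_mul, mul_assoc, div_mul_cancel₀ _ hz]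
  simp only [mul_apply_two, den]
  push_cast; ring

lemma mobius_mul {g h : SL(2, ℝ)} {z : ℂ} (hz : den h z ≠ 0) :
    mobius (g * h) z = mobius g (mobius h z) := by
  rw [mobius_def (g * h), den_mul hz, mobius_def g,
    ← mul_div_mul_right _ (den g (mobius h z)) hz]
  congr 1
  rw [mobius_def, add_mul, mul_assoc, div_mul_cancel₀ _ hz]
  simp only [mul_apply_two, den]
  push_cast; ring

lemma mobius_one (z : ℂ) : mobius 1 z = z := by simp [mobius]

lemma mobius_sub_mobius {g : SL(2, ℝ)} {z w : ℂ} (hz : den g z ≠ 0) (hw : den g w ≠ 0) :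
    mobius g z - mobius g w = (z - w) / (den g z * den g w) := by
  rw [mobius_def, mobius_def, div_sub_div _ _ hz hw]
  congr 1
  have hdet : ((g 0 0 : ℂ) * g 1 1 - g 0 1 * g 1 0) = 1 := by exact_mod_cast det_eq g
  simp only [den]
  linear_combination (z - w) * hdet

lemma deriv_mobius {g : SL(2, ℝ)} {z : ℂ} (hz : den g z ≠ 0) :
    deriv (mobius g) z = 1 / den g z ^ 2 := by
  have h1 : HasDerivAt (fun z : ℂ => (g 0 0 : ℂ) * z + (g 0 1 : ℂ)) (g 0 0 : ℂ) z := by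
    simpa using ((hasDerivAt_id z).const_mul (g 0 0 : ℂ)).add_const (g 0 1 : ℂ)
  have h2 : HasDerivAt (fun z : ℂ => (g 1 0 : ℂ) * z + (g 1 1 : ℂ)) (g 1 0 : ℂ) z := by
    simpa using ((hasDerivAt_id z).const_mul (g 1 0 : ℂ)).add_const (g 1 1 : ℂ)
  have h3 := (h1.div h2 hz).deriv
  have hdet : ((g 0 0 : ℂ) * g 1 1 - g 0 1 * g 1 0) = 1 := by exact_mod_cast det_eq g
  refine Eq.trans h3 ?_
  unfold den
  congr 1
  linear_combination hdet

lemma mobius_im_eq_zero (g : SL(2, ℝ)) {z : ℂ} (hz : z.im = 0) : (mobius g z).im = 0 := by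
  obtain ⟨x, rfl⟩ : ∃ x : ℝ, z = x := ⟨z.re, Complex.ext rfl hz⟩
  have : mobius g x = (((g 0 0) * x + g 0 1) / (g 1 0 * x + g 1 1) : ℝ) := by
    simp [mobius]
  rw [this, Complex.ofReal_im]

lemma den_ne_zero_of_im_ne_zero (g : SL(2, ℝ)) {z : ℂ} (hz : z.im ≠ 0) : den g z ≠ 0 := by
  intro h
  have him := congrArg Complex.im h
  have hre := congrArg Complex.re h
  simp [den, hz] at him hre
  have := det_eq g
  simp [him] at this hre
  simp [hre] at this

lemma coe_smul_upperHalfPlane (g : SL(2, ℝ)) (z : UpperHalfPlane) :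
    ((g • z : UpperHalfPlane) : ℂ) = mobius g z := by
  rw [UpperHalfPlane.specialLinearGroup_apply]
  simp [mobius]

lemma mapGL_smul_coe (g : SL(2, ℝ)) (z : ℂ) :
    Matrix.SpecialLinearGroup.mapGL ℂ g • (z : OnePoint ℂ) =
      if den g z = 0 then OnePoint.infty else ((mobius g z : ℂ) : OnePoint ℂ) := by
  rw [OnePoint.smul_some_eq_ite]
  simp only [den, mobius, Matrix.SpecialLinearGroup.mapGL_coe_matrix,
    Matrix.SpecialLinearGroup.map_apply_coe, RingHom.mapMatrix_apply, Matrix.map_apply,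
    Complex.coe_algebraMap]
  congr

lemma mapGL_smul_infty (g : SL(2, ℝ)) :
    Matrix.SpecialLinearGroup.mapGL ℂ g • (OnePoint.infty : OnePoint ℂ) =
      if g 1 0 = 0 then OnePoint.infty else (((g 0 0 / g 1 0 : ℝ) : ℂ) : OnePoint ℂ) := by
  rw [OnePoint.smul_infty_eq_ite]
  simp

variable {m : ℕ}

@[simp] lemma bar_bar (a : Letter m) : bar (bar a) = a := by simp [bar]

lemma bar_ne (a : Letter m) : a ≠ bar a := by
  intro h
  have := congrArg Prod.snd h
  simp [bar] at this

lemma eq_bar_iff {a b : Letter m} : a = bar b ↔ a.1 = b.1 ∧ a.2 ≠ b.2 := by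
  rw [Prod.ext_iff]
  simp [bar, Bool.eq_not]

lemma isReduced_cons_cons_iff {a b : Letter m} {w : List (Letter m)} :
    FreeGroup.IsReduced (a :: b :: w) ↔ b ≠ bar a ∧ FreeGroup.IsReduced (b :: w) := by
  rw [FreeGroup.isReduced_cons_cons, ne_eq, eq_bar_iff]
  constructor
  · rintro ⟨h, h'⟩
    exact ⟨fun h2 => h2.2 (h h2.1.symm).symm, h'⟩
  · rintro ⟨h, h'⟩
    refine ⟨fun h2 => ?_, h'⟩
    by_contra h3
    exact h ⟨h2.symm, fun h4 => h3 h4.symm⟩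

lemma isReduced_append {u w : List (Letter m)} {b : Letter m} (hu : FreeGroup.IsReduced u)
    (hw : FreeGroup.IsReduced w) (hb : b ∈ w.head?) (hub : Follows u b) :
    FreeGroup.IsReduced (u ++ w) := by
  refine List.isChain_append.2 ⟨hu, hw, fun x hx y hy => ?_⟩
  obtain rfl : y = b := Option.mem_unique hy hb
  have := hub x hx
  rw [ne_eq, eq_bar_iff] at this
  exact fun h => not_not.1 fun h' => this ⟨h, h'⟩

lemma isReduced_append_singleton {w : List (Letter m)} {b : Letter m}
    (hw : FreeGroup.IsReduced w) (hb : Follows w b) : FreeGroup.IsReduced (w ++ [b]) :=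
  isReduced_append hw FreeGroup.IsReduced.singleton (by simp) hb

lemma follows_append {u w : List (Letter m)} (hw : w ≠ []) {b : Letter m} (h : Follows w b) :
    Follows (u ++ w) b := by
  intro x hx
  rw [List.getLast?_append_of_ne_nil _ hw] at hx
  exact h x hx

lemma follows_append_singleton {w : List (Letter m)} {a b : Letter m} :
    Follows (w ++ [a]) b ↔ a ≠ bar b := by
  simp [Follows]

lemma follows_getLast_of_isReduced {w w' : List (Letter m)} {b : Letter m}
    (h : FreeGroup.IsReduced (w ++ b :: w')) : Follows w b := by
  induction w with
  | nil => intro x hx; simp at hx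
  | cons a w ih =>
    cases w with
    | nil =>
      have := (isReduced_cons_cons_iff.1 h).1
      intro x hx
      simp only [List.getLast?_singleton, Option.mem_def, Option.some.injEq] at hx
      subst hx
      intro h2
      exact this (by rw [h2, bar_bar])
    | cons c w =>
      intro x hx
      exact ih (isReduced_cons_cons_iff.1 h).2 x (by simpa using hx)

lemma isReduced_invRev {w : List (Letter m)} (h : FreeGroup.IsReduced w) :
    FreeGroup.IsReduced (FreeGroup.invRev w) := by
  rw [FreeGroup.isReduced_iff_reduce_eq, FreeGroup.reduce_invRev, h.reduce_eq]

lemma head?_invRev (w : List (Letter m)) :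
    (FreeGroup.invRev w).head? = w.getLast?.map bar := by
  simp [FreeGroup.invRev, List.head?_reverse, List.getLast?_map]
  rfl

lemma getLast?_invRev (w : List (Letter m)) :
    (FreeGroup.invRev w).getLast? = w.head?.map bar := by
  simp [FreeGroup.invRev, List.getLast?_reverse]
  rfl

namespace Data

variable (S : Data m)

lemma wordMap_eq_lift (w : List (Letter m)) :
    S.wordMap w = FreeGroup.lift S.gen (FreeGroup.mk w) := by
  rw [FreeGroup.lift_mk, wordMap]
  congr 2
  ext x
  cases h : x.2 <;> simp [letterMap, h]

lemma wordMap_append (u v : List (Letter m)) :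
    S.wordMap (u ++ v) = S.wordMap u * S.wordMap v := by
  simp [wordMap]

lemma wordMap_cons (a : Letter m) (v : List (Letter m)) :
    S.wordMap (a :: v) = letterMap S.gen a * S.wordMap v := by
  simp [wordMap]

lemma wordMap_singleton (a : Letter m) : S.wordMap [a] = letterMap S.gen a := by
  simp [wordMap]

lemma wordMap_invRev (w : List (Letter m)) :
    S.wordMap (FreeGroup.invRev w) = (S.wordMap w)⁻¹ := by
  rw [wordMap_eq_lift, wordMap_eq_lift, ← FreeGroup.inv_mk, map_inv]

lemma wordMap_reduce (w : List (Letter m)) : S.wordMap (FreeGroup.reduce w) = S.wordMap w := by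
  rw [wordMap_eq_lift, wordMap_eq_lift, ← FreeGroup.toWord_mk, FreeGroup.mk_toWord]

lemma wordMap_mem_group (w : List (Letter m)) : S.wordMap w ∈ S.group := by
  apply Subgroup.list_prod_mem
  intro x hx
  obtain ⟨a, -, rfl⟩ := List.mem_map.1 hx
  exact Subgroup.subset_closure ⟨a, rfl⟩

lemma exists_wordMap_eq {g : SL(2, ℝ)} (hg : g ∈ S.group) :
    ∃ w, FreeGroup.IsReduced w ∧ S.wordMap w = g := by
  have h1 : S.group ≤ (FreeGroup.lift S.gen).range := by
    rw [group, Subgroup.closure_le]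
    rintro _ ⟨a, rfl⟩
    exact ⟨FreeGroup.mk [a], by rw [← wordMap_eq_lift, wordMap_singleton]⟩
  obtain ⟨x, rfl⟩ := h1 hg
  exact ⟨x.toWord, FreeGroup.isReduced_toWord, by rw [wordMap_eq_lift, FreeGroup.mk_toWord]⟩

/-- The closed disk `D̄_a`. -/
def cdisk (a : Letter m) : Set ℂ := Metric.closedBall (S.center a : ℂ) (S.radius a)

lemma disk_subset_cdisk (a : Letter m) : S.disk a ⊆ S.cdisk a := Metric.ball_subset_closedBall

lemma notMem_disk_of_mem_cdisk {a b : Letter m} (hab : a ≠ b) {z : ℂ} (hz : z ∈ S.cdisk a) :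
    z ∉ S.disk b := fun h =>
  Set.disjoint_left.1 (S.disjoint_closedBall a b hab) hz (S.disk_subset_cdisk b h)

/-- Ping-pong on the sphere: a point outside the disk `D_l̄` of the inverse of the last letter `l` of `w`
is mapped by `γ_w` into the closed disk of the first letter. -/
lemma smul_mem_cdisk {w : List (Letter m)} (hw : FreeGroup.IsReduced w) {x : OnePoint ℂ}
    (hx : ∀ l ∈ w.getLast?, x ∉ (fun z : ℂ => (z : OnePoint ℂ)) '' S.disk (bar l)) :
    ∀ a ∈ w.head?, Matrix.SpecialLinearGroup.mapGL ℂ (S.wordMap w) • x ∈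
      (fun z : ℂ => (z : OnePoint ℂ)) '' S.cdisk a := by
  induction w with
  | nil => simp
  | cons a w ih =>
    intro a' ha'
    simp only [List.head?_cons, Option.mem_def, Option.some.injEq] at ha'
    subst ha'
    rw [wordMap_cons, map_mul, mul_smul, cdisk, ← S.image_compl]
    refine Set.mem_image_of_mem _ ?_
    cases w with
    | nil => simpa [wordMap, disk] using hx
    | cons c w =>
      rw [isReduced_cons_cons_iff] at hw
      obtain ⟨z, hz, hzx⟩ := ih hw.2 (fun l hl => hx l (by simpa using hl)) c (by simp)
      rw [← hzx]
      rintro ⟨z', hz', h⟩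
      obtain rfl : z' = z := OnePoint.coe_injective h
      exact S.notMem_disk_of_mem_cdisk hw.1 hz hz'

/-- The point `z` lies outside the disk `D_l̄`, where `l` is the last letter of `w`. -/
def Avoids (w : List (Letter m)) (z : ℂ) : Prop := ∀ l ∈ w.getLast?, z ∉ S.disk (bar l)

variable {S}

lemma avoids_of_mem_cdisk {w : List (Letter m)} {b : Letter m} (h : Follows w b) {z : ℂ}
    (hz : z ∈ S.cdisk b) : S.Avoids w z := fun l hl =>
  S.notMem_disk_of_mem_cdisk (fun hb => h l hl (by rw [hb, bar_bar])) hz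

lemma Avoids.den_ne_zero_and {w : List (Letter m)} (hw : FreeGroup.IsReduced w) {z : ℂ}
    (hz : S.Avoids w z) :
    den (S.wordMap w) z ≠ 0 ∧ ∀ a ∈ w.head?, mobius (S.wordMap w) z ∈ S.cdisk a := by
  cases w with
  | nil => simp [wordMap, den]
  | cons a w =>
    obtain ⟨y, hy, hyz⟩ := S.smul_mem_cdisk hw (x := (z : OnePoint ℂ)) (by
      rintro l hl ⟨z', hz', h⟩
      obtain rfl : z' = z := OnePoint.coe_injective h
      exact hz l hl hz') a (by simp)
    rw [mapGL_smul_coe] at hyz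
    split_ifs at hyz with h0
    · exact absurd hyz (OnePoint.coe_ne_infty _)
    · refine ⟨h0, fun a' ha' => ?_⟩
      simp only [List.head?_cons, Option.mem_def, Option.some.injEq] at ha'
      subst ha'
      obtain rfl := OnePoint.coe_injective hyz
      exact hy

lemma Avoids.den_ne_zero {w : List (Letter m)} (hw : FreeGroup.IsReduced w) {z : ℂ}
    (hz : S.Avoids w z) : den (S.wordMap w) z ≠ 0 := (hz.den_ne_zero_and hw).1

lemma Avoids.mobius_mem {w : List (Letter m)} (hw : FreeGroup.IsReduced w) {z : ℂ}
    (hz : S.Avoids w z) {a : Letter m} (ha : a ∈ w.head?) :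
    mobius (S.wordMap w) z ∈ S.cdisk a := (hz.den_ne_zero_and hw).2 a ha

/-- The point `γ_w(∞)` is finite and lies in the closed disk of the first letter of `w`. -/
lemma image_infty {w : List (Letter m)} (hw : FreeGroup.IsReduced w) {a : Letter m}
    (ha : a ∈ w.head?) : S.wordMap w 1 0 ≠ 0 ∧
      |S.wordMap w 0 0 / S.wordMap w 1 0 - S.center a| ≤ S.radius a := by
  obtain ⟨y, hy, hyz⟩ := S.smul_mem_cdisk hw (x := OnePoint.infty) (by
      rintro l hl ⟨z', hz', h⟩
      exact OnePoint.coe_ne_infty _ h) a ha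
  rw [mapGL_smul_infty] at hyz
  split_ifs at hyz with h0
  · exact absurd hyz (OnePoint.coe_ne_infty _)
  · refine ⟨h0, ?_⟩
    obtain rfl := OnePoint.coe_injective hyz
    rw [cdisk, Metric.mem_closedBall, Complex.dist_eq, ← Complex.ofReal_sub,
      Complex.norm_real] at hy
    exact hy

variable (S) in
/-- The pole `γ_w⁻¹(∞)` of `γ_w`. -/
noncomputable def pole (w : List (Letter m)) : ℝ := -(S.wordMap w 1 1) / S.wordMap w 1 0

lemma lower_left_ne_zero {w : List (Letter m)} (hw : FreeGroup.IsReduced w) (h0 : w ≠ []) :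
    S.wordMap w 1 0 ≠ 0 :=
  (image_infty hw (List.head_mem_head? h0)).1

lemma lower_right_eq {w : List (Letter m)} (hw : FreeGroup.IsReduced w) (h0 : w ≠ []) :
    S.wordMap w 1 1 = -(S.wordMap w 1 0 * S.pole w) := by
  have := lower_left_ne_zero (S := S) hw h0
  rw [pole]; field_simp

lemma den_eq {w : List (Letter m)} (hw : FreeGroup.IsReduced w) (h0 : w ≠ []) (z : ℂ) :
    den (S.wordMap w) z = S.wordMap w 1 0 * (z - S.pole w) := by
  rw [den, lower_right_eq hw h0]; push_cast; ring

/-- The pole of `γ_w` is the image of `∞` under the mirror word, and so lies in the closed disk of the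
inverse of the last letter of `w`. -/
lemma pole_mem {w : List (Letter m)} (hw : FreeGroup.IsReduced w) {l : Letter m}
    (hl : l ∈ w.getLast?) : |S.pole w - S.center (bar l)| ≤ S.radius (bar l) := by
  have h := (image_infty (S := S) (isReduced_invRev hw) (a := bar l) (by
    rw [head?_invRev]; exact Option.mem_map_of_mem bar hl)).2
  rw [wordMap_invRev, inv_apply_zero_zero, inv_apply_one_zero] at h
  rwa [pole, neg_div, ← div_neg]

variable (S) in
/-- Uniform constants for Schottky data: a lower bound `sep` for the distances between the
disks, and an upper bound `bd` for the disks and for the entries of the generators. -/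
structure Bounds where
  sep : ℝ
  bd : ℝ
  sep_pos : 0 < sep
  sep_le_one : sep ≤ 1
  one_le_bd : 1 ≤ bd
  sep_le : ∀ a b, a ≠ b → sep + S.radius a + S.radius b ≤ |S.center a - S.center b|
  disk_le : ∀ a, |S.center a| + S.radius a ≤ bd
  entry_le : ∀ a i j, |letterMap S.gen a i j| ≤ bd

lemma exists_pos_le_of_finite {ι : Type*} [Finite ι] (f : ι → ℝ) (hf : ∀ i, 0 < f i) :
    ∃ c, 0 < c ∧ c ≤ 1 ∧ ∀ i, c ≤ f i := by
  have := Fintype.ofFinite ι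
  refine ⟨(Finset.univ.image f ∪ {1}).min' (by simp), ?_, ?_, ?_⟩
  · rw [Finset.lt_min'_iff]
    intro y hy
    simp only [Finset.mem_union, Finset.mem_image, Finset.mem_univ, true_and,
      Finset.mem_singleton] at hy
    rcases hy with ⟨i, rfl⟩ | rfl
    · exact hf i
    · exact one_pos
  · exact Finset.min'_le _ _ (by simp)
  · exact fun i => Finset.min'_le _ _ (by simp)

lemma exists_ge_of_finite {ι : Type*} [Finite ι] (f : ι → ℝ) :
    ∃ c, 1 ≤ c ∧ ∀ i, f i ≤ c := by
  obtain ⟨c, hc⟩ := (Set.finite_range f).bddAbove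
  exact ⟨max c 1, le_max_right _ _, fun i => (hc ⟨i, rfl⟩).trans (le_max_left _ _)⟩

variable (S) in
lemma nonempty_bounds : Nonempty S.Bounds := by
  have hsep : ∀ a b : Letter m, a ≠ b → S.radius a + S.radius b < |S.center a - S.center b| := by
    intro a b hab
    have := S.disjoint_closedBall a b hab
    rw [disjoint_closedBall_closedBall_iff (S.radius_pos a).le (S.radius_pos b).le,
      Complex.dist_eq, ← Complex.ofReal_sub, Complex.norm_real] at this
    exact this
  obtain ⟨η, h0, h1, h2⟩ := exists_pos_le_of_finite
    (fun p : {p : Letter m × Letter m // p.1 ≠ p.2} =>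
      |S.center p.1.1 - S.center p.1.2| - (S.radius p.1.1 + S.radius p.1.2))
    (fun p => sub_pos.2 (hsep _ _ p.2))
  obtain ⟨R, h3, h4⟩ := exists_ge_of_finite fun a => |S.center a| + S.radius a
  obtain ⟨R', -, h5⟩ := exists_ge_of_finite
    fun p : Letter m × Fin 2 × Fin 2 => |letterMap S.gen p.1 p.2.1 p.2.2|
  exact ⟨⟨η, max R R', h0, h1, h3.trans (le_max_left _ _),
    fun a b hab => by have := h2 ⟨(a, b), hab⟩; simp only at this; linarith,
    fun a => (h4 a).trans (le_max_left _ _),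
    fun a i j => (h5 (a, i, j)).trans (le_max_right _ _)⟩⟩

namespace Bounds

variable (β : S.Bounds)

lemma bd_pos : 0 < β.bd := one_pos.trans_le β.one_le_bd

lemma norm_le {a : Letter m} {z : ℂ} (hz : z ∈ S.cdisk a) : ‖z‖ ≤ β.bd := by
  rw [cdisk, Metric.mem_closedBall, Complex.dist_eq] at hz
  have h1 : ‖z‖ ≤ ‖z - S.center a‖ + ‖(S.center a : ℂ)‖ := by
    simpa using norm_add_le (z - S.center a) (S.center a : ℂ)
  rw [Complex.norm_real, Real.norm_eq_abs] at h1
  linarith [β.disk_le a]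

lemma abs_le {a : Letter m} {x : ℝ} (hx : |x - S.center a| ≤ S.radius a) : |x| ≤ β.bd := by
  have h1 : |x| ≤ |x - S.center a| + |S.center a| := by
    simpa using abs_add_le (x - S.center a) (S.center a)
  linarith [β.disk_le a]

lemma abs_pole_le {w : List (Letter m)} (hw : FreeGroup.IsReduced w) (h0 : w ≠ []) :
    |S.pole w| ≤ β.bd :=
  β.abs_le (pole_mem hw (List.getLast_mem_getLast? h0))

/-- A disk that may follow `w` lies in a half-plane at distance `sep` from the pole of `γ_w`. -/
lemma sep_le_re_sub_pole {w : List (Letter m)} (hw : FreeGroup.IsReduced w) (h0 : w ≠ [])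
    {b : Letter m} (hb : Follows w b) :
    (∀ z ∈ S.cdisk b, β.sep ≤ z.re - S.pole w) ∨ (∀ z ∈ S.cdisk b, β.sep ≤ S.pole w - z.re) := by
  set l := w.getLast h0 with hl
  have hlm : l ∈ w.getLast? := List.getLast_mem_getLast? h0
  have hp := abs_sub_le_iff.1 (pole_mem (S := S) hw hlm)
  have hs := β.sep_le b (bar l) (fun h => hb l hlm (by rw [h, bar_bar]))
  have hre : ∀ z ∈ S.cdisk b, |z.re - S.center b| ≤ S.radius b := by
    intro z hz
    rw [cdisk, Metric.mem_closedBall, Complex.dist_eq] at hz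
    simpa using (Complex.abs_re_le_norm _).trans hz
  rcases le_total (S.center b) (S.center (bar l)) with h | h
  · right
    intro z hz
    have := abs_sub_le_iff.1 (hre z hz)
    rw [abs_of_nonpos (by linarith)] at hs
    linarith
  · left
    intro z hz
    have := abs_sub_le_iff.1 (hre z hz)
    rw [abs_of_nonneg (by linarith)] at hs
    linarith

lemma sep_le_norm_sub_pole {w : List (Letter m)} (hw : FreeGroup.IsReduced w) (h0 : w ≠ [])
    {b : Letter m} (hb : Follows w b) {z : ℂ} (hz : z ∈ S.cdisk b) :
    β.sep ≤ ‖z - S.pole w‖ := by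
  have h1 : |z.re - S.pole w| ≤ ‖z - S.pole w‖ := by
    simpa using Complex.abs_re_le_norm (z - S.pole w)
  rcases β.sep_le_re_sub_pole hw h0 hb with h | h
  · exact (h z hz).trans ((le_abs_self _).trans h1)
  · exact (h z hz).trans ((le_abs_self _).trans ((abs_sub_comm _ _).le.trans h1))

lemma norm_sub_pole_le {w : List (Letter m)} (hw : FreeGroup.IsReduced w) (h0 : w ≠ [])
    {b : Letter m} {z : ℂ} (hz : z ∈ S.cdisk b) : ‖z - S.pole w‖ ≤ 2 * β.bd := by
  refine (norm_sub_le _ _).trans ?_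
  rw [Complex.norm_real, Real.norm_eq_abs]
  linarith [β.norm_le hz, β.abs_pole_le hw h0]

lemma norm_mobius_sub {w : List (Letter m)} (hw : FreeGroup.IsReduced w) (h0 : w ≠ [])
    {b b' : Letter m} (hb : Follows w b) (hb' : Follows w b') {z z' : ℂ} (hz : z ∈ S.cdisk b)
    (hz' : z' ∈ S.cdisk b') : ‖mobius (S.wordMap w) z - mobius (S.wordMap w) z'‖ =
      ‖z - z'‖ / (S.wordMap w 1 0 ^ 2 * (‖z - S.pole w‖ * ‖z' - S.pole w‖)) := by
  rw [mobius_sub_mobius ((avoids_of_mem_cdisk hb hz).den_ne_zero hw)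
    ((avoids_of_mem_cdisk hb' hz').den_ne_zero hw), den_eq hw h0, den_eq hw h0, norm_div]
  congr 1
  simp only [norm_mul, Complex.norm_real, Real.norm_eq_abs]
  rw [← sq_abs]; ring

lemma norm_mobius_sub_le {w : List (Letter m)} (hw : FreeGroup.IsReduced w) (h0 : w ≠ [])
    {b b' : Letter m} (hb : Follows w b) (hb' : Follows w b') {z z' : ℂ} (hz : z ∈ S.cdisk b)
    (hz' : z' ∈ S.cdisk b') : ‖mobius (S.wordMap w) z - mobius (S.wordMap w) z'‖ ≤
      2 * β.bd / (S.wordMap w 1 0 ^ 2 * β.sep ^ 2) := by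
  rw [norm_mobius_sub hw h0 hb hb' hz hz']
  have hc := lower_left_ne_zero (S := S) hw h0
  have := β.sep_pos
  have hd : ‖z - z'‖ ≤ 2 * β.bd := by
    linarith [norm_sub_le z z', β.norm_le hz, β.norm_le hz']
  have := β.bd_pos
  gcongr
  rw [sq β.sep]
  exact mul_le_mul (β.sep_le_norm_sub_pole hw h0 hb hz) (β.sep_le_norm_sub_pole hw h0 hb' hz')
    β.sep_pos.le (norm_nonneg _)

lemma le_norm_mobius_sub {w : List (Letter m)} (hw : FreeGroup.IsReduced w) (h0 : w ≠ [])
    {b b' : Letter m} (hb : Follows w b) (hb' : Follows w b') {z z' : ℂ} (hz : z ∈ S.cdisk b)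
    (hz' : z' ∈ S.cdisk b') : ‖z - z'‖ / (S.wordMap w 1 0 ^ 2 * (2 * β.bd) ^ 2) ≤
      ‖mobius (S.wordMap w) z - mobius (S.wordMap w) z'‖ := by
  rw [norm_mobius_sub hw h0 hb hb' hz hz']
  have hc := lower_left_ne_zero (S := S) hw h0
  have h1 := β.sep_pos.trans_le (β.sep_le_norm_sub_pole hw h0 hb hz)
  have h2 := β.sep_pos.trans_le (β.sep_le_norm_sub_pole hw h0 hb' hz')
  have := β.bd_pos
  gcongr
  rw [sq (2 * β.bd)]
  exact mul_le_mul (β.norm_sub_pole_le hw h0 hz) (β.norm_sub_pole_le hw h0 hz')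
    (norm_nonneg _) (by positivity)

lemma lower_left_append_le {w : List (Letter m)} (hw : FreeGroup.IsReduced w) (h0 : w ≠ [])
    (a : Letter m) : |S.wordMap (w ++ [a]) 1 0| ≤ 2 * β.bd ^ 2 * |S.wordMap w 1 0| := by
  rw [wordMap_append, wordMap_singleton, mul_apply_two, lower_right_eq hw h0]
  have h1 : S.wordMap w 1 0 * letterMap S.gen a 0 0
      + -(S.wordMap w 1 0 * S.pole w) * letterMap S.gen a 1 0
      = S.wordMap w 1 0 * (letterMap S.gen a 0 0 - S.pole w * letterMap S.gen a 1 0) := by ring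
  rw [h1, abs_mul, mul_comm]
  gcongr
  refine (abs_sub _ _).trans ?_
  rw [abs_mul]
  have h2 := mul_le_mul (β.abs_pole_le hw h0) (β.entry_le a 1 0) (abs_nonneg _) β.bd_pos.le
  nlinarith [β.entry_le a 0 0, β.one_le_bd]

end Bounds

end Data

end Schottky

/-! ### Discreteness and the limit set -/

lemma Set.Infinite.exists_ne_dist_lt {ι X : Type*} [PseudoMetricSpace X] {s : Set ι}
    (hs : s.Infinite) {f : ι → X} {K : Set X} (hK : TotallyBounded K) (hf : Set.MapsTo f s K)
    {ε : ℝ} (hε : 0 < ε) : ∃ u ∈ s, ∃ v ∈ s, u ≠ v ∧ dist (f u) (f v) < ε := by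
  obtain ⟨t, ht, hKt⟩ := Metric.totallyBounded_iff.1 hK (ε / 2) (by positivity)
  have h1 : ∀ u ∈ s, ∃ y ∈ t, dist (f u) y < ε / 2 := fun u hu => by
    simpa using hKt (hf hu)
  have : Nonempty X := hs.nonempty.elim fun u _ => ⟨f u⟩
  choose! g hgt hg using h1
  obtain ⟨u, hu, v, hv, huv, h⟩ := hs.exists_ne_map_eq_of_mapsTo (fun u hu => hgt u hu) ht
  refine ⟨u, hu, v, hv, huv, ?_⟩
  have h2 := hg u hu
  have h3 := hg v hv
  rw [← h] at h3
  have := dist_triangle_right (f u) (f v) (g u)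
  linarith

namespace Schottky

variable {m : ℕ}

lemma reduce_append_invRev_ne_nil {u v : List (Letter m)} (hu : FreeGroup.IsReduced u)
    (hv : FreeGroup.IsReduced v) (huv : u ≠ v) :
    FreeGroup.reduce (u ++ FreeGroup.invRev v) ≠ [] := by
  intro h
  apply huv
  rw [← FreeGroup.toWord_mk, FreeGroup.toWord_eq_nil_iff, ← FreeGroup.mul_mk,
    ← FreeGroup.inv_mk, mul_inv_eq_one] at h
  have := congrArg FreeGroup.toWord h
  rwa [FreeGroup.toWord_mk, FreeGroup.toWord_mk, hu.reduce_eq, hv.reduce_eq] at this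

lemma isReduced_reduce (w : List (Letter m)) : FreeGroup.IsReduced (FreeGroup.reduce w) := by
  rw [← FreeGroup.toWord_mk]; exact FreeGroup.isReduced_toWord

namespace Data

variable {S : Data m}

lemma wordMap_reduce_append_invRev (u v : List (Letter m)) :
    S.wordMap (FreeGroup.reduce (u ++ FreeGroup.invRev v)) = S.wordMap u * (S.wordMap v)⁻¹ := by
  rw [wordMap_reduce, wordMap_append, wordMap_invRev]

lemma center_mem_cdisk (a : Letter m) : (S.center a : ℂ) ∈ S.cdisk a :=
  Metric.mem_closedBall_self (S.radius_pos a).le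

namespace Bounds

lemma upper_left_le (β : S.Bounds) {w : List (Letter m)} (hw : FreeGroup.IsReduced w) (h0 : w ≠ []) :
    |S.wordMap w 0 0| ≤ β.bd * |S.wordMap w 1 0| := by
  have h := image_infty (S := S) hw (List.head_mem_head? h0)
  have h1 := β.abs_le h.2
  rwa [abs_div, div_le_iff₀ (abs_pos.2 h.1)] at h1

lemma abs_entry_le (β : S.Bounds) {w : List (Letter m)} (hw : FreeGroup.IsReduced w) (h0 : w ≠ [])
    (i j : Fin 2) : |S.wordMap w i j| ≤ 3 * β.bd ^ 2 * |S.wordMap w 1 0| := by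
  set c := |S.wordMap w 1 0| with hc
  have hc0 : 0 ≤ c := abs_nonneg _
  have hR := β.one_le_bd
  have hR2 : β.bd ≤ 3 * β.bd ^ 2 := by nlinarith
  have h00 := β.upper_left_le hw h0
  have h11 : |S.wordMap w 1 1| ≤ β.bd * c := by
    rw [lower_right_eq hw h0, abs_neg, abs_mul, mul_comm]
    gcongr
    exact β.abs_pole_le hw h0
  have h01 : |S.wordMap w 0 1| ≤ 3 * β.bd ^ 2 * c := by
    have hl : Follows w (w.getLast h0) := by
      intro x hx
      obtain rfl : x = w.getLast h0 := Option.mem_unique hx (List.getLast_mem_getLast? h0)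
      exact bar_ne _
    have hz := center_mem_cdisk (S := S) (w.getLast h0)
    have hd := (avoids_of_mem_cdisk hl hz).den_ne_zero hw
    have h1 := β.norm_le ((avoids_of_mem_cdisk hl hz).mobius_mem hw (List.head_mem_head? h0))
    have h2 := β.norm_sub_pole_le hw h0 hz
    have h3 := β.norm_le hz
    set o : ℝ := S.center (w.getLast h0) with ho
    rw [mobius_def, norm_div, div_le_iff₀ (norm_pos_iff.2 hd), den_eq hw h0, norm_mul,
      Complex.norm_real, Real.norm_eq_abs, ← hc] at h1
    have h4 : |S.wordMap w 0 1| ≤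
        ‖(S.wordMap w 0 0 : ℂ) * o + S.wordMap w 0 1‖ + ‖(S.wordMap w 0 0 : ℂ) * o‖ := by
      rw [← Real.norm_eq_abs, ← Complex.norm_real]
      simpa using norm_sub_le ((S.wordMap w 0 0 : ℂ) * o + S.wordMap w 0 1)
        ((S.wordMap w 0 0 : ℂ) * o)
    rw [norm_mul, Complex.norm_real (S.wordMap w 0 0), Real.norm_eq_abs] at h4
    have h5 : |S.wordMap w 0 0| * ‖(o : ℂ)‖ ≤ (β.bd * c) * β.bd :=
      mul_le_mul h00 h3 (norm_nonneg _) (by positivity)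
    have h6 : β.bd * (c * ‖(o : ℂ) - S.pole w‖) ≤ β.bd * (c * (2 * β.bd)) := by gcongr
    nlinarith
  have hle : β.bd * c ≤ 3 * β.bd ^ 2 * c := by gcongr
  fin_cases i <;> fin_cases j
  · exact h00.trans hle
  · exact h01
  · simp only [Fin.mk_one, Fin.zero_eta]
    rw [← hc]
    nlinarith
  · exact h11.trans hle

/-- Discreteness of `Γ` in quantitative form. If infinitely many words had bounded lower left
entries, two of the matrices would be so close that `γ_u γ_v⁻¹` is near the identity; but `γ_u γ_v⁻¹`
maps `∞` into one of the disks. -/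
theorem finite_lower_left_le (β : S.Bounds) (M : ℝ) :
    {w | FreeGroup.IsReduced w ∧ w ≠ [] ∧ |S.wordMap w 1 0| ≤ M}.Finite := by
  by_contra hinf
  have hinf : Set.Infinite _ := hinf
  have hR := β.one_le_bd
  set Q := 3 * β.bd ^ 2 * |M| + 1 with hQ
  have hQ0 : 0 < Q := by positivity
  have hentry : ∀ w, FreeGroup.IsReduced w → w ≠ [] → |S.wordMap w 1 0| ≤ M →
      ∀ i j, |S.wordMap w i j| ≤ Q := by
    intro w hw h0 hM i j
    refine (β.abs_entry_le hw h0 i j).trans ?_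
    have : 3 * β.bd ^ 2 * |S.wordMap w 1 0| ≤ 3 * β.bd ^ 2 * |M| := by
      exact mul_le_mul_of_nonneg_left (hM.trans (le_abs_self M)) (by positivity)
    linarith
  set ε := 1 / (4 * Q * (1 + β.bd)) with hε
  have hε0 : 0 < ε := by positivity
  obtain ⟨u, ⟨hu, hu0, huM⟩, v, ⟨hv, hv0, hvM⟩, huv, hd⟩ := hinf.exists_ne_dist_lt
    (f := fun w => (fun i j => S.wordMap w i j : Fin 2 → Fin 2 → ℝ))
    (K := Metric.closedBall 0 Q) (ProperSpace.isCompact_closedBall 0 Q).totallyBounded (by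
      rintro w ⟨hw, hw0, hwM⟩
      rw [mem_closedBall_zero_iff, pi_norm_le_iff_of_nonneg hQ0.le]
      intro i
      rw [pi_norm_le_iff_of_nonneg hQ0.le]
      exact hentry w hw hw0 hwM i) hε0
  have hdist : ∀ i j, |S.wordMap u i j - S.wordMap v i j| ≤ ε := fun i j =>
    ((dist_le_pi_dist (fun j => S.wordMap u i j) (fun j => S.wordMap v i j) j).trans
      (dist_le_pi_dist (fun i j => S.wordMap u i j) (fun i j => S.wordMap v i j) i)).trans hd.le
  have hw := β.upper_left_le (isReduced_reduce _) (reduce_append_invRev_ne_nil hu hv huv)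
  rw [wordMap_reduce_append_invRev, mul_apply_two, mul_apply_two, inv_apply_zero_zero,
    inv_apply_one_zero] at hw
  have hdet := det_eq (S.wordMap v)
  have hpr : ∀ i j l, |(S.wordMap u i j - S.wordMap v i j) * S.wordMap v 1 l| ≤ ε * Q := by
    intro i j l
    rw [abs_mul]
    exact mul_le_mul (hdist i j) (hentry v hv hv0 hvM 1 l) (abs_nonneg _) hε0.le
  have hA : 1 - 2 * (ε * Q) ≤
      |S.wordMap u 0 0 * S.wordMap v 1 1 + S.wordMap u 0 1 * -S.wordMap v 1 0| := by
    refine le_trans ?_ (le_abs_self _)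
    have h1 := neg_abs_le ((S.wordMap u 0 0 - S.wordMap v 0 0) * S.wordMap v 1 1)
    have h2 := le_abs_self ((S.wordMap u 0 1 - S.wordMap v 0 1) * S.wordMap v 1 0)
    linarith [hpr 0 0 1, hpr 0 1 0]
  have hC : |S.wordMap u 1 0 * S.wordMap v 1 1 + S.wordMap u 1 1 * -S.wordMap v 1 0| ≤
      2 * (ε * Q) := by
    have : S.wordMap u 1 0 * S.wordMap v 1 1 + S.wordMap u 1 1 * -S.wordMap v 1 0 =
      (S.wordMap u 1 0 - S.wordMap v 1 0) * S.wordMap v 1 1 -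
        (S.wordMap u 1 1 - S.wordMap v 1 1) * S.wordMap v 1 0 := by ring
    rw [this]
    refine (abs_sub _ _).trans ?_
    linarith [hpr 1 0 1, hpr 1 1 0]
  have h1 : 2 * (ε * Q) * (1 + β.bd) = 1 / 2 := by
    rw [hε]; field_simp; norm_num
  have h2 : β.bd * |S.wordMap u 1 0 * S.wordMap v 1 1 + S.wordMap u 1 1 * -S.wordMap v 1 0| ≤
      β.bd * (2 * (ε * Q)) := by gcongr
  nlinarith

lemma exists_length_lt_lower_left (β : S.Bounds) (M : ℝ) :
    ∃ L : ℕ, ∀ w, FreeGroup.IsReduced w → w ≠ [] → L ≤ w.length → M < |S.wordMap w 1 0| := by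
  obtain ⟨L, hL⟩ := ((β.finite_lower_left_le M).image List.length).bddAbove
  refine ⟨L + 1, fun w hw h0 hl => ?_⟩
  by_contra! h
  have := hL ⟨w, ⟨hw, h0, h⟩, rfl⟩
  omega

/-- Long words contract the disks to any prescribed size. -/
lemma exists_length_dist_lt (β : S.Bounds) {ε : ℝ} (hε : 0 < ε) :
    ∃ L : ℕ, ∀ w, FreeGroup.IsReduced w → w ≠ [] → L ≤ w.length → ∀ b b', Follows w b →
      Follows w b' → ∀ z ∈ S.cdisk b, ∀ z' ∈ S.cdisk b',
        ‖mobius (S.wordMap w) z - mobius (S.wordMap w) z'‖ < ε := by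
  have hs := β.sep_pos
  have hR := β.bd_pos
  set M := Real.sqrt (2 * β.bd / (ε * β.sep ^ 2)) with hM
  have hM2 : M ^ 2 = 2 * β.bd / (ε * β.sep ^ 2) := Real.sq_sqrt (by positivity)
  have hM0 : 0 < M := Real.sqrt_pos.2 (by positivity)
  obtain ⟨L, hL⟩ := β.exists_length_lt_lower_left M
  refine ⟨L, fun w hw h0 hl b b' hb hb' z hz z' hz' => ?_⟩
  refine (β.norm_mobius_sub_le hw h0 hb hb' hz hz').trans_lt ?_
  have h1 := hL w hw h0 hl
  have h2 : M ^ 2 < S.wordMap w 1 0 ^ 2 := by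
    rw [← sq_abs (S.wordMap w 1 0)]
    gcongr
  rw [hM2, div_lt_iff₀ (by positivity)] at h2
  have hc : 0 < S.wordMap w 1 0 ^ 2 := by
    have := lower_left_ne_zero (S := S) hw h0
    positivity
  rw [div_lt_iff₀ (by positivity)]
  linarith

end Bounds

lemma continuousOn_mobius {w : List (Letter m)} (hw : FreeGroup.IsReduced w) {b : Letter m}
    (hb : Follows w b) : ContinuousOn (mobius (S.wordMap w)) (S.cdisk b) := by
  unfold mobius
  refine ContinuousOn.div (by fun_prop) (by fun_prop) fun z hz => ?_
  exact (avoids_of_mem_cdisk hb hz).den_ne_zero hw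

variable (S) in
/-- The union of the closed disks of generation `n`: the images `γ_w(D̄_b)` over the reduced words
`w` of length `n` and the letters `b` with `w → b`. -/
def generation (n : ℕ) : Set ℂ :=
  ⋃ w ∈ {w : List (Letter m) | w.length = n}, ⋃ b,
    ⋃ (_ : FreeGroup.IsReduced w ∧ Follows w b), mobius (S.wordMap w) '' S.cdisk b

lemma mem_generation {n : ℕ} {p : ℂ} : p ∈ S.generation n ↔ ∃ w : List (Letter m),
    w.length = n ∧ ∃ b, (FreeGroup.IsReduced w ∧ Follows w b) ∧
      ∃ y ∈ S.cdisk b, mobius (S.wordMap w) y = p := by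
  simp only [generation, Set.mem_iUnion, Set.mem_ofPred_eq, Set.mem_image, exists_prop]

lemma isClosed_generation (n : ℕ) : IsClosed (S.generation n) := by
  refine (List.finite_length_eq (Letter m) n).isClosed_biUnion fun w _ =>
    isClosed_iUnion_of_finite fun b => isClosed_iUnion_of_finite fun h => ?_
  exact ((ProperSpace.isCompact_closedBall _ _).image_of_continuousOn
    (continuousOn_mobius h.1 h.2)).isClosed

/-- All but finitely many points of an orbit in the upper half-plane lie in the disks of
generation `n`. -/
lemma exists_length_orbit_mem_generation (z : UpperHalfPlane) (n : ℕ) :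
    ∃ L : ℕ, ∀ w, FreeGroup.IsReduced w → L ≤ w.length →
      mobius (S.wordMap w) z ∈ S.generation n := by
  obtain ⟨β⟩ := S.nonempty_bounds
  obtain ⟨L, hL⟩ := β.exists_length_dist_lt z.im_pos
  refine ⟨n + 1 + (L + 1), fun w hw hl => ?_⟩
  have hzi : (z : ℂ).im ≠ 0 := z.im_pos.ne'
  obtain ⟨u, a, v, rfl, hu, hv⟩ : ∃ u a v, w = u ++ a :: v ∧ u.length = n ∧ L + 1 ≤ v.length := by
    have h1 : n < w.length := by omega
    refine ⟨w.take n, w[n], w.drop (n + 1), ?_, by simp; omega, by simp; omega⟩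
    rw [← List.drop_eq_getElem_cons h1, List.take_append_drop]
  have hav : FreeGroup.IsReduced (a :: v) := hw.infix (List.suffix_append _ _).isInfix
  have hvr : FreeGroup.IsReduced v := hav.infix (List.suffix_cons _ _).isInfix
  have hv0 : v ≠ [] := by rintro rfl; simp at hv
  have hur : FreeGroup.IsReduced u := hw.infix (List.prefix_append _ _).isInfix
  set y := mobius (S.wordMap v) z with hy
  -- If `γ_v z` were in `D_ā`, then `z` would lie in a tiny disk centred on the real line.
  have hya : S.Avoids [a] y := by
    intro l hl hyl
    obtain rfl : a = l := by simpa using hl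
    have hinv : FreeGroup.IsReduced (FreeGroup.invRev v) := isReduced_invRev hvr
    have hinv0 : FreeGroup.invRev v ≠ [] := by
      intro h
      have := FreeGroup.invRev_length (L₁ := v)
      rw [h] at this
      simp at this
      exact hv0 (List.length_eq_zero_iff.1 this.symm)
    have hf : Follows (FreeGroup.invRev v) (bar a) := by
      intro x hx hxa
      rw [getLast?_invRev] at hx
      obtain ⟨c, hc, rfl⟩ := Option.mem_map.1 hx
      rw [bar_bar] at hxa
      cases v with
      | nil => simp at hc
      | cons d v =>
        obtain rfl : d = c := by simpa using hc
        exact (isReduced_cons_cons_iff.1 hav).1 (by rw [← hxa, bar_bar])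
    have h1 := hL _ hinv hinv0 (by rw [FreeGroup.invRev_length]; omega) _ _ hf hf y
      (S.disk_subset_cdisk _ hyl) _ (center_mem_cdisk (bar a))
    have h2 : mobius (S.wordMap (FreeGroup.invRev v)) y = z := by
      rw [wordMap_invRev, hy, ← mobius_mul (den_ne_zero_of_im_ne_zero _ hzi), inv_mul_cancel,
        mobius_one]
    have h3 := (Complex.abs_im_le_norm _).trans_lt h1
    rw [h2, Complex.sub_im, mobius_im_eq_zero _ (Complex.ofReal_im _), sub_zero] at h3
    exact absurd ((le_abs_self _).trans_lt h3) (lt_irrefl _)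
  have hra : FreeGroup.IsReduced [a] := FreeGroup.IsReduced.singleton
  refine mem_generation.2 ⟨u, hu, a, ⟨hur, follows_getLast_of_isReduced hw⟩,
    mobius (S.wordMap [a]) y, hya.mobius_mem hra (by simp), ?_⟩
  have hd1 := hya.den_ne_zero hra
  have hd2 : den (S.wordMap v) z ≠ 0 := den_ne_zero_of_im_ne_zero _ hzi
  have hd3 : den (S.wordMap (a :: v)) z ≠ 0 := by
    rw [← List.singleton_append, wordMap_append, den_mul hd2]
    exact mul_ne_zero hd1 hd2
  rw [wordMap_append, mobius_mul hd3, ← List.singleton_append (l := v), wordMap_append,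
    mobius_mul hd2]

lemma limitSet_subset_generation (n : ℕ) : S.limitSet ⊆ S.generation n := by
  rintro p ⟨z, hp⟩
  obtain ⟨L, hL⟩ := exists_length_orbit_mem_generation (S := S) z n
  set A : Set ℂ := (fun w => mobius (S.wordMap w) z) '' {w | w.length < L} with hA
  have hAf : A.Finite := (List.finite_length_lt _ L).image _
  have hsub : Set.range (fun g : S.group => (((g : SL(2, ℝ)) • z : UpperHalfPlane) : ℂ)) ⊆
      A ∪ S.generation n := by
    rintro _ ⟨⟨g, hg⟩, rfl⟩
    obtain ⟨w, hw, rfl⟩ := S.exists_wordMap_eq hg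
    simp only [coe_smul_upperHalfPlane]
    rcases lt_or_ge w.length L with h | h
    · exact Or.inl ⟨w, h, rfl⟩
    · exact Or.inr (hL w hw h)
  rw [accPt_principal_iff_clusterPt, ← mem_closure_iff_clusterPt] at hp
  have h1 := closure_mono (Set.sdiff_subset_sdiff_left hsub) hp
  rw [Set.union_sdiff_distrib, closure_union, (hAf.subset Set.sdiff_subset).isClosed.closure_eq] at h1
  rcases h1 with h1 | h1
  · exact absurd rfl h1.2
  · exact (isClosed_generation n).closure_subset_iff.2 Set.sdiff_subset h1

lemma im_eq_zero_of_mem_limitSet {p : ℂ} (hp : p ∈ S.limitSet) : p.im = 0 := by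
  obtain ⟨β⟩ := S.nonempty_bounds
  by_contra h
  obtain ⟨L, hL⟩ := β.exists_length_dist_lt (abs_pos.2 h)
  obtain ⟨w, hwl, b, ⟨hw, hb⟩, y, hy, rfl⟩ := mem_generation.1
    (limitSet_subset_generation (L + 1) hp)
  have h0 : w ≠ [] := by rintro rfl; simp at hwl
  have h1 := hL w hw h0 (by omega) b b hb hb y hy _ (center_mem_cdisk b)
  have h2 := (Complex.abs_im_le_norm _).trans_lt h1
  rw [Complex.sub_im, mobius_im_eq_zero _ (Complex.ofReal_im _), sub_zero] at h2
  exact lt_irrefl _ h2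

/-- Each limit point lies in a disk `γ_w(D̄_b)` whose size is prescribed up to a constant. -/
lemma Bounds.exists_word_of_mem_limitSet (β : S.Bounds) {p : ℂ} (hp : p ∈ S.limitSet) {M : ℝ}
    (hM : β.bd ≤ M) : ∃ w, FreeGroup.IsReduced w ∧ w ≠ [] ∧ M < |S.wordMap w 1 0| ∧
      |S.wordMap w 1 0| ≤ 2 * β.bd ^ 2 * M ∧ ∃ b, Follows w b ∧
        ∃ y ∈ S.cdisk b, mobius (S.wordMap w) y = p := by
  obtain ⟨L, hL⟩ := β.exists_length_lt_lower_left M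
  obtain ⟨w, hwl, b, ⟨hw, hb⟩, y, hy, hyp⟩ := mem_generation.1
    (limitSet_subset_generation (L + 1) hp)
  have h0 : w ≠ [] := by rintro rfl; simp at hwl
  have hc := hL w hw h0 (by omega)
  clear hwl hL
  -- Remove last letters as long as the lower left entry stays above `M`.
  induction w using List.reverseRecOn generalizing b y with
  | nil => exact absurd rfl h0
  | append_singleton w a ih =>
    have hwr : FreeGroup.IsReduced w := hw.infix (List.prefix_append _ _).isInfix
    have hwa : Follows w a := follows_getLast_of_isReduced hw
    rcases eq_or_ne w [] with rfl | hw0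
    · rw [List.nil_append, wordMap_singleton] at hc
      exact absurd (hc.trans_le (β.entry_le a 1 0)) (not_lt.2 hM)
    rcases lt_or_ge M |S.wordMap w 1 0| with h | h
    · have hav : S.Avoids [a] y := avoids_of_mem_cdisk
        (by rw [follows_append_singleton] at hb; simpa [Follows] using hb) hy
      have hra : FreeGroup.IsReduced [a] := FreeGroup.IsReduced.singleton
      refine ih a hwr hwa (mobius (S.wordMap [a]) y) (hav.mobius_mem hra (by simp)) ?_ hw0 h
      rw [← mobius_mul (hav.den_ne_zero hra), ← wordMap_append, hyp]
    · refine ⟨w ++ [a], hw, h0, hc, ?_, b, hb, y, hy, hyp⟩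
      refine (β.lower_left_append_le hwr hw0 a).trans ?_
      have := β.bd_pos
      gcongr

end Data

end Schottky

/-! ### Return words and the area of the neighbourhoods of the limit set -/

namespace Schottky

variable {m : ℕ}

/-- The concatenation `W_{s 0} W_{s 1} ⋯ W_{s (k-1)}`. -/
def concatWord {ι : Type*} (W : ι → List (Letter m)) (s : ℕ → ι) : ℕ → List (Letter m)
  | 0 => []
  | k + 1 => concatWord W s k ++ W (s k)

/-- The word `w` is reduced, starts with `a`, and can be followed by `a`, so that `γ_w` maps the
closed disk `D̄_a` into itself. -/
def IsReturnWord (a : Letter m) (w : List (Letter m)) : Prop :=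
  FreeGroup.IsReduced w ∧ a ∈ w.head? ∧ Follows w a

lemma IsReturnWord.ne_nil {a : Letter m} {w : List (Letter m)} (h : IsReturnWord a w) :
    w ≠ [] := by
  rintro rfl; simpa using h.2.1

lemma concatWord_spec {ι : Type*} {W : ι → List (Letter m)} {a : Letter m}
    (hW : ∀ i, IsReturnWord a (W i)) (s : ℕ → ι) (k : ℕ) :
    FreeGroup.IsReduced (concatWord W s k) ∧ Follows (concatWord W s k) a ∧
      k ≤ (concatWord W s k).length := by
  induction k with
  | zero => exact ⟨FreeGroup.IsReduced.nil, by simp [Follows, concatWord], by simp⟩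
  | succ k ih =>
    have h := hW (s k)
    refine ⟨isReduced_append ih.1 h.1 h.2.1 ih.2.1, follows_append h.ne_nil h.2.2, ?_⟩
    have := List.length_pos_iff.2 h.ne_nil
    simp only [concatWord, List.length_append]
    omega

/-- Two given letters never exhaust the alphabet. -/
lemma exists_letter_ne_ne (hm : 2 ≤ m) (a b : Letter m) : ∃ x : Letter m, x ≠ a ∧ x ≠ b := by
  by_contra! h
  have h1 : (Finset.univ : Finset (Letter m)) ⊆ {a, b} := by
    intro x _
    by_cases hx : x = a
    · simp [hx]
    · simp [h x hx]
  have h2 := (Finset.card_le_card h1).trans Finset.card_le_two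
  simp [Letter] at h2
  omega

namespace Data

variable {S : Data m}

variable (S) in
/-- The real points of the closed disk `D̄_a`. -/
def rdisk (a : Letter m) : Set ℂ := S.cdisk a ∩ {z | z.im = 0}

lemma isCompact_rdisk (a : Letter m) : IsCompact (S.rdisk a) :=
  (ProperSpace.isCompact_closedBall _ _).inter_right
    (isClosed_eq Complex.continuous_im continuous_const)

lemma center_mem_rdisk (a : Letter m) : (S.center a : ℂ) ∈ S.rdisk a :=
  ⟨center_mem_cdisk a, Complex.ofReal_im _⟩

lemma mapsTo_rdisk {a : Letter m} {w : List (Letter m)} (h : IsReturnWord a w) :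
    Set.MapsTo (mobius (S.wordMap w)) (S.rdisk a) (S.rdisk a) := fun _ hz =>
  ⟨(avoids_of_mem_cdisk h.2.2 hz.1).mobius_mem h.1 h.2.1, mobius_im_eq_zero _ hz.2⟩

lemma iterComp_eq_mobius {ι : Type*} {W : ι → List (Letter m)} {a : Letter m}
    (hW : ∀ i, IsReturnWord a (W i)) (s : ℕ → ι) (k : ℕ) {z : ℂ} (hz : z ∈ S.rdisk a) :
    iterComp (fun i => mobius (S.wordMap (W i))) s k z =
      mobius (S.wordMap (concatWord W s k)) z := by
  induction k generalizing z with
  | zero => simp [iterComp, concatWord, wordMap, mobius_one]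
  | succ k ih =>
    have h := hW (s k)
    rw [concatWord, wordMap_append,
      mobius_mul ((avoids_of_mem_cdisk h.2.2 hz.1).den_ne_zero h.1), ← ih (mapsTo_rdisk h hz)]
    rfl

/-- The attractor of finitely many return words consists of limit points. -/
lemma mem_limitSet_of_forall_iterComp {ι : Type*} {W : ι → List (Letter m)} {a : Letter m}
    (hW : ∀ i, IsReturnWord a (W i)) (s : ℕ → ι) {p : ℂ}
    (hp : ∀ k, p ∈ iterComp (fun i => mobius (S.wordMap (W i))) s k '' S.rdisk a) :
    p ∈ S.limitSet := by
  obtain ⟨β⟩ := S.nonempty_bounds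
  have hr := S.radius_pos a
  -- An orbit through a point of the upper half-plane inside `D_a` follows the nested disks.
  set z₀ : UpperHalfPlane := ⟨(S.center a : ℂ) + Complex.I * S.radius a, by simpa using hr⟩ with hz₀
  have hz₀m : (z₀ : ℂ) ∈ S.cdisk a := by
    rw [cdisk, Metric.mem_closedBall, Complex.dist_eq]
    simp [hz₀, abs_of_pos hr]
  have hpim : p.im = 0 := by
    obtain ⟨z, hz, rfl⟩ := hp 0
    exact hz.2
  refine ⟨z₀, ?_⟩
  rw [accPt_principal_iff_clusterPt, ← mem_closure_iff_clusterPt, Metric.mem_closure_iff]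
  intro ε hε
  obtain ⟨L, hL⟩ := β.exists_length_dist_lt hε
  obtain ⟨h1, h2, h3⟩ := concatWord_spec hW s (L + 1)
  obtain ⟨z, hz, hzp⟩ := hp (L + 1)
  rw [iterComp_eq_mobius hW s _ hz] at hzp
  have h0 : concatWord W s (L + 1) ≠ [] := by
    intro h; rw [h] at h3; simp at h3
  refine ⟨mobius (S.wordMap (concatWord W s (L + 1))) z₀,
    ⟨⟨⟨_, S.wordMap_mem_group _⟩, coe_smul_upperHalfPlane _ _⟩, ?_⟩, ?_⟩
  · rw [Set.mem_singleton_iff, ← coe_smul_upperHalfPlane]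
    intro h
    have := UpperHalfPlane.im_pos (S.wordMap (concatWord W s (L + 1)) • z₀)
    rw [UpperHalfPlane.im, h, hpim] at this
    exact lt_irrefl _ this
  · rw [← hzp, Complex.dist_eq]
    exact hL _ h1 h0 (by omega) a a h2 h2 z hz.1 z₀ hz₀m

lemma dimH_limitSet_eq : dimH S.limitSet = ENNReal.ofReal S.delta :=
  (ENNReal.ofReal_toReal (Real.dimH_ne_top _)).symm

/-- For `p ∈ Λ` and a small scale `h`, some return word contracts `D̄_a` into the
`h / 4`-neighbourhood of `p` without contracting much more than that. -/
lemma Bounds.exists_returnWord_near (hm : 2 ≤ m) (β : S.Bounds) {p : ℂ} (hp : p ∈ S.limitSet)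
    {h : ℝ} (hh : 0 < h) (hh1 : h ≤ 1 / β.bd) :
    ∃ a w, IsReturnWord a w ∧ (∀ z ∈ S.rdisk a, dist (mobius (S.wordMap w) z) p ≤ h / 4) ∧
      ∀ z ∈ S.rdisk a, ∀ z' ∈ S.rdisk a, β.sep ^ 2 / (512 * β.bd ^ 11) * h * dist z z' ≤
        dist (mobius (S.wordMap w) z) (mobius (S.wordMap w) z') := by
  have hs := β.sep_pos
  have hs1 := β.sep_le_one
  have hR1 := β.one_le_bd
  have hR := β.bd_pos
  set M := Real.sqrt (8 * β.bd / (h * β.sep ^ 2)) with hMdef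
  have hM2 : M ^ 2 = 8 * β.bd / (h * β.sep ^ 2) := Real.sq_sqrt (by positivity)
  have hM0 : 0 < M := Real.sqrt_pos.2 (by positivity)
  have hM : β.bd ≤ M := by
    apply Real.le_sqrt_of_sq_le
    rw [le_div_iff₀ (by positivity)]
    have h1 : h * β.bd ≤ 1 := by rwa [le_div_iff₀ hR] at hh1
    have h2 : β.sep ^ 2 ≤ 1 := pow_le_one₀ hs.le hs1
    calc β.bd ^ 2 * (h * β.sep ^ 2) = β.bd * ((h * β.bd) * β.sep ^ 2) := by ring
      _ ≤ β.bd * (1 * 1) := by gcongr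
      _ ≤ 8 * β.bd := by linarith
  obtain ⟨w, hw, hw0, hMw, hwM, b, hb, y, hy, rfl⟩ := β.exists_word_of_mem_limitSet hp hM
  set a := w.head hw0 with ha
  obtain ⟨x, hx1, hx2⟩ := exists_letter_ne_ne hm (bar (w.getLast hw0)) (bar a)
  have hwx : Follows w x := by
    intro l hl hlx
    obtain rfl : l = w.getLast hw0 := Option.mem_unique hl (List.getLast_mem_getLast? hw0)
    exact hx1 (by rw [hlx, bar_bar])
  have hret : IsReturnWord a (w ++ [x]) := by
    refine ⟨isReduced_append_singleton hw hwx, ?_, follows_append_singleton.2 hx2⟩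
    rw [List.head?_append_of_ne_nil _ hw0]
    exact List.head_mem_head? hw0
  have hrx : FreeGroup.IsReduced [x] := FreeGroup.IsReduced.singleton
  have hax : ∀ z ∈ S.rdisk a, S.Avoids [x] z := fun z hz =>
    avoids_of_mem_cdisk (follows_append_singleton (w := []).2 hx2) hz.1
  refine ⟨a, w ++ [x], hret, fun z hz => ?_, fun z hz z' hz' => ?_⟩
  · rw [wordMap_append, mobius_mul ((hax z hz).den_ne_zero hrx), Complex.dist_eq]
    refine (β.norm_mobius_sub_le hw hw0 hwx hb ((hax z hz).mobius_mem hrx (by simp)) hy).trans ?_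
    have h1 : M ^ 2 ≤ S.wordMap w 1 0 ^ 2 := by
      rw [← sq_abs (S.wordMap w 1 0)]; gcongr
    calc 2 * β.bd / (S.wordMap w 1 0 ^ 2 * β.sep ^ 2) ≤ 2 * β.bd / (M ^ 2 * β.sep ^ 2) := by
          gcongr
      _ = h / 4 := by rw [hM2]; field_simp; norm_num
  · rw [Complex.dist_eq, Complex.dist_eq]
    refine le_trans ?_ (β.le_norm_mobius_sub hret.1 hret.ne_nil hret.2.2 hret.2.2 hz.1 hz'.1)
    have hc := lower_left_ne_zero (S := S) hret.1 hret.ne_nil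
    have h1 : |S.wordMap (w ++ [x]) 1 0| ≤ 4 * β.bd ^ 4 * M := by
      refine (β.lower_left_append_le hw hw0 x).trans ?_
      calc 2 * β.bd ^ 2 * |S.wordMap w 1 0| ≤ 2 * β.bd ^ 2 * (2 * β.bd ^ 2 * M) := by gcongr
        _ = _ := by ring
    have h2 : S.wordMap (w ++ [x]) 1 0 ^ 2 ≤ (4 * β.bd ^ 4 * M) ^ 2 := by
      rw [← sq_abs]; gcongr
    calc β.sep ^ 2 / (512 * β.bd ^ 11) * h * ‖z - z'‖
        = ‖z - z'‖ / ((4 * β.bd ^ 4 * M) ^ 2 * (2 * β.bd) ^ 2) := by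
          rw [mul_pow _ M, hM2]; field_simp; ring
      _ ≤ _ := by gcongr

/-- Subsets of the limit set whose points are `h`-separated have at most `K h ^ (-δ)` points. The
points that share a first letter give a family of return words, to which the dimension bound
for attractors applies. -/
theorem exists_card_separated_le (hm : 2 ≤ m) (S : Data m) : ∃ K h₁ : ℝ, 0 < K ∧ 0 < h₁ ∧
    ∀ h, 0 < h → h < h₁ → ∀ P : Finset ℂ, (↑P : Set ℂ) ⊆ S.limitSet →
      (∀ p ∈ P, ∀ q ∈ P, p ≠ q → h ≤ dist p q) → (P.card : ℝ) ≤ K * h ^ (-S.delta) := by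
  obtain ⟨β⟩ := S.nonempty_bounds
  have hs := β.sep_pos
  have hs1 := β.sep_le_one
  have hR1 := β.one_le_bd
  have hR := β.bd_pos
  set κ := β.sep ^ 2 / (512 * β.bd ^ 11) with hκ
  have hκ0 : 0 < κ := by positivity
  have hκ1 : κ < 1 := by
    rw [hκ, div_lt_one (by positivity)]
    have h2 : β.sep ^ 2 ≤ 1 := pow_le_one₀ hs.le hs1
    have h3 : 1 ≤ β.bd ^ 11 := one_le_pow₀ hR1
    linarith
  have hmpos : (0 : ℝ) < Fintype.card (Letter m) := by
    have : 0 < Fintype.card (Letter m) := by simp [Letter]; omega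
    exact_mod_cast this
  refine ⟨Fintype.card (Letter m) * κ ^ (-S.delta), 1 / β.bd, by positivity, by positivity, ?_⟩
  intro h hh hh1 P hP hsep
  have hh2 : h < 1 := hh1.trans_le (by rw [div_le_one hR]; exact hR1)
  have : Nonempty (Letter m) := Fintype.card_pos_iff.1 (by exact_mod_cast hmpos)
  choose! A W hret hnear hexp using fun (p : ℂ) (hp : p ∈ S.limitSet) =>
    β.exists_returnWord_near hm hp hh hh1.le
  have hfib : ∀ a : Letter m, ((P.filter fun p => A p = a).card : ℝ) ≤ (κ * h) ^ (-S.delta) := by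
    intro a
    set Q := P.filter fun p => A p = a with hQ
    have hQP : ∀ p ∈ Q, p ∈ P ∧ p ∈ S.limitSet ∧ A p = a := fun p hp =>
      ⟨(Finset.mem_filter.1 hp).1, hP (Finset.mem_filter.1 hp).1, (Finset.mem_filter.1 hp).2⟩
    have hW : ∀ i : Q, IsReturnWord a (W i) := fun i => by
      have := hQP i i.2
      rw [← this.2.2]; exact hret _ this.2.1
    have hmain := natCast_le_rpow_neg_of_dimH_le (ι := Q) (F := S.rdisk a)
      (ψ := fun i => mobius (S.wordMap (W i))) (c := κ * h) (η := h / 2) (E := S.limitSet)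
      (δ := S.delta) (fun i => mapsTo_rdisk (hW i)) (isCompact_rdisk a)
      ⟨_, center_mem_rdisk a⟩
      (fun i => (continuousOn_mobius (hW i).1 (hW i).2.2).mono Set.inter_subset_left)
      (by positivity) (by nlinarith) (by positivity) ?_ ?_
      (fun s p hp => mem_limitSet_of_forall_iterComp hW s hp) ENNReal.toReal_nonneg
      dimH_limitSet_eq.le
    · simpa using hmain
    · intro i x hx y hy
      obtain ⟨-, h2, h3⟩ := hQP i i.2
      exact hexp i h2 x (h3 ▸ hx) y (h3 ▸ hy)
    · intro i j hij x hx y hy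
      obtain ⟨h1, h2, h3⟩ := hQP i i.2
      obtain ⟨h1', h2', h3'⟩ := hQP j j.2
      have h4 := hnear i h2 x (h3 ▸ hx)
      have h5 := hnear j h2' y (h3' ▸ hy)
      have h6 := hsep i h1 j h1' (fun h => hij (Subtype.ext h))
      have h7 := dist_triangle4 (i : ℂ) (mobius (S.wordMap (W i)) x) (mobius (S.wordMap (W j)) y) j
      rw [dist_comm (i : ℂ) (mobius _ _)] at h7
      linarith
  calc (P.card : ℝ) = ∑ a : Letter m, ((P.filter fun p => A p = a).card : ℝ) := by
        rw [Finset.card_eq_sum_card_fiberwise (f := A) (t := Finset.univ) (by simp)]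
        push_cast; rfl
    _ ≤ ∑ _a : Letter m, (κ * h) ^ (-S.delta) := Finset.sum_le_sum fun a _ => hfib a
    _ = _ := by
        rw [Finset.sum_const, nsmul_eq_mul, Real.mul_rpow hκ0.le hh.le, Finset.card_univ]
        ring

open MeasureTheory in
/-- The area of `Ω_b(h)`: the balls of radius `2 * h` around a maximal `h`-separated subset of the limit
set cover it. -/
theorem exists_volume_omega_le (hm : 2 ≤ m) (S : Data m) : ∃ K h₁ : ℝ, 0 < K ∧ 0 < h₁ ∧
    ∀ h, 0 < h → h < h₁ → ∀ b, volume (S.omega b h) ≤ ENNReal.ofReal (K * h ^ (2 - S.delta)) := by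
  obtain ⟨K, h₁, hK, hh₁, hcard⟩ := exists_card_separated_le hm S
  refine ⟨K * (4 * Real.pi), h₁, by positivity, hh₁, fun h hh hlt b => ?_⟩
  -- A separated subset of maximal cardinality is a net.
  set N : Set ℕ := {n | ∃ P : Finset ℂ, (↑P : Set ℂ) ⊆ S.limitSet ∧
      (∀ p ∈ P, ∀ q ∈ P, p ≠ q → h ≤ dist p q) ∧ P.card = n} with hN
  have hbdd : BddAbove N := by
    refine ⟨⌊K * h ^ (-S.delta)⌋₊, ?_⟩
    rintro n ⟨P, h1, h2, rfl⟩
    exact Nat.le_floor (hcard h hh hlt P h1 h2)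
  obtain ⟨P, hPΛ, hPs, hPc⟩ : sSup N ∈ N :=
    Nat.sSup_mem ⟨0, ∅, by simp, by simp, rfl⟩ hbdd
  have hnet : ∀ p ∈ S.limitSet, ∃ q ∈ P, dist p q < h := by
    intro p hp
    by_contra! hcon
    have hpP : p ∉ P := fun hpP => by
      have := hcon p hpP
      rw [dist_self] at this
      linarith
    have hmem : P.card + 1 ∈ N := by
      refine ⟨insert p P, ?_, ?_, Finset.card_insert_of_notMem hpP⟩
      · rw [Finset.coe_insert]
        exact Set.insert_subset hp hPΛ
      · intro x hx y hy hxy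
        rcases Finset.mem_insert.1 hx with rfl | hx' <;>
          rcases Finset.mem_insert.1 hy with rfl | hy'
        · exact absurd rfl hxy
        · exact hcon y hy'
        · rw [dist_comm]; exact hcon x hx'
        · exact hPs x hx' y hy' hxy
    have := le_csSup hbdd hmem
    omega
  have hcover : S.omega b h ⊆ ⋃ q ∈ P, Metric.ball q (2 * h) := by
    rintro z ⟨hz, -⟩
    obtain ⟨p, hp, y, hy, rfl⟩ := Set.mem_add.1 hz
    obtain ⟨q, hq, hpq⟩ := hnet p hp
    simp only [Set.mem_iUnion]
    refine ⟨q, hq, ?_⟩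
    rw [Metric.mem_ball, Complex.dist_eq] at *
    rw [sub_zero] at hy
    calc ‖p + y - q‖ = ‖(p - q) + y‖ := by ring_nf
      _ ≤ ‖p - q‖ + ‖y‖ := norm_add_le _ _
      _ < 2 * h := by linarith
  calc volume (S.omega b h) ≤ ∑ q ∈ P, volume (Metric.ball q (2 * h)) :=
        (measure_mono hcover).trans (measure_biUnion_finset_le _ _)
    _ = ENNReal.ofReal (P.card * ((2 * h) ^ 2 * Real.pi)) := by
        simp_rw [Complex.volume_ball]
        rw [Finset.sum_const, nsmul_eq_mul, ENNReal.ofReal_mul (Nat.cast_nonneg _),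
          ENNReal.ofReal_mul (p := (2 * h) ^ 2) (by positivity), ENNReal.ofReal_natCast,
          ENNReal.ofReal_pow (by positivity)]
        congr 2
        rw [← NNReal.coe_real_pi, ENNReal.ofReal_coe_nnreal]
    _ ≤ _ := by
        apply ENNReal.ofReal_le_ofReal
        have h1 := hcard h hh hlt P hPΛ hPs
        calc (P.card : ℝ) * ((2 * h) ^ 2 * Real.pi)
            ≤ (K * h ^ (-S.delta)) * ((2 * h) ^ 2 * Real.pi) := by gcongr
          _ = K * (4 * Real.pi) * (h ^ (2 : ℝ) * h ^ (-S.delta)) := by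
              rw [Real.rpow_two]; ring
          _ = _ := by rw [← Real.rpow_add hh]; ring_nf

end Data

end Schottky

/-! ### The phase -/

lemma Complex.abs_arg_le_abs_im_div_re {ζ : ℂ} (h : 0 < ζ.re) : |ζ.arg| ≤ |ζ.im| / ζ.re := by
  have h1 : |ζ.arg| < Real.pi / 2 := Complex.abs_arg_lt_pi_div_two_iff.2 (Or.inl h)
  refine (Real.le_tan (abs_nonneg _) h1).trans (le_of_eq ?_)
  rcases abs_cases ζ.arg with ⟨h2, h3⟩ | ⟨h2, h3⟩
  · rw [h2, Complex.tan_arg, abs_of_nonneg (Complex.arg_nonneg_iff.1 h3)]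
  · rw [h2, Real.tan_neg, Complex.tan_arg, abs_of_neg (Complex.arg_neg_iff.1 h3), neg_div]

lemma Complex.log_inv_sq {ζ : ℂ} (h : 0 < ζ.re) :
    Complex.log (ζ ^ 2)⁻¹ = -2 * Complex.log ζ := by
  have h0 : ζ ≠ 0 := by rintro rfl; simp at h
  have h1 := abs_lt.1 (Complex.abs_arg_lt_pi_div_two_iff.2 (Or.inl h))
  have h2 : (ζ ^ 2)⁻¹ = Complex.exp (-2 * Complex.log ζ) := by
    rw [neg_mul, Complex.exp_neg, two_mul, Complex.exp_add, Complex.exp_log h0, sq]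
  rw [h2, Complex.log_exp] <;> simp [Complex.log_im] <;> linarith

namespace Schottky

variable {m : ℕ}

namespace Data

variable {S : Data m}

open ComplexConjugate in
lemma conj_mem_cdisk {b : Letter m} {z : ℂ} (hz : z ∈ S.cdisk b) : conj z ∈ S.cdisk b := by
  rw [cdisk, Metric.mem_closedBall, Complex.dist_eq] at *
  rwa [← Complex.conj_ofReal (S.center b), ← map_sub, Complex.norm_conj]

lemma wordDeriv_eq {w : List (Letter m)} (hw : FreeGroup.IsReduced w) (h0 : w ≠ [])
    {b : Letter m} (hb : Follows w b) {z : ℂ} (hz : z ∈ S.cdisk b) :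
    S.wordDeriv w z = ((S.wordMap w 1 0 * (z - S.pole w)) ^ 2)⁻¹ := by
  rw [wordDeriv, deriv_mobius ((avoids_of_mem_cdisk hb hz).den_ne_zero hw), den_eq hw h0, one_div]

/-- On a disk that may follow `w` the derivative `γ_w'` is the inverse square of an affine function
with values in the right half-plane, so that its principal logarithm is explicit. -/
lemma Bounds.exists_log_wordDeriv (β : S.Bounds) {w : List (Letter m)}
    (hw : FreeGroup.IsReduced w) (h0 : w ≠ []) {b : Letter m} (hb : Follows w b) :
    ∃ s : ℝ, s ≠ 0 ∧ ∀ z ∈ S.cdisk b, |s| * β.sep ≤ (s * (z - S.pole w) : ℂ).re ∧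
      Complex.log (S.wordDeriv w z) = -2 * Complex.log (s * (z - S.pole w)) := by
  have hc := lower_left_ne_zero (S := S) hw h0
  obtain ⟨s, hs2, hs⟩ : ∃ s : ℝ, s ^ 2 = S.wordMap w 1 0 ^ 2 ∧
      ∀ z ∈ S.cdisk b, |s| * β.sep ≤ (s * (z - S.pole w) : ℂ).re := by
    rcases β.sep_le_re_sub_pole hw h0 hb with h | h
    · refine ⟨|S.wordMap w 1 0|, sq_abs _, fun z hz => ?_⟩
      rw [abs_abs, Complex.re_ofReal_mul]
      gcongr
      simpa using h z hz
    · refine ⟨-|S.wordMap w 1 0|, by rw [neg_sq, sq_abs], fun z hz => ?_⟩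
      rw [abs_neg, abs_abs, Complex.re_ofReal_mul, neg_mul, ← mul_neg]
      gcongr
      simpa using h z hz
  have hs0 : s ≠ 0 := by
    rintro rfl
    rw [zero_pow two_ne_zero, eq_comm, sq_eq_zero_iff] at hs2
    exact hc hs2
  refine ⟨s, hs0, fun z hz => ⟨hs z hz, ?_⟩⟩
  have hpos : 0 < (s * (z - S.pole w) : ℂ).re :=
    (mul_pos (abs_pos.2 hs0) β.sep_pos).trans_le (hs z hz)
  rw [wordDeriv_eq hw h0 hb hz, ← Complex.log_inv_sq hpos]
  congr 2
  rw [mul_pow, mul_pow]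
  congr 1
  exact_mod_cast hs2.symm

lemma Bounds.abs_im_log_wordDeriv_le (β : S.Bounds) {w : List (Letter m)}
    (hw : FreeGroup.IsReduced w) (h0 : w ≠ []) {b : Letter m} (hb : Follows w b) {z : ℂ}
    (hz : z ∈ S.cdisk b) : |(Complex.log (S.wordDeriv w z)).im| ≤ 2 * (|z.im| / β.sep) := by
  obtain ⟨s, hs0, hs⟩ := β.exists_log_wordDeriv hw h0 hb
  obtain ⟨h1, h2⟩ := hs z hz
  have hsep := β.sep_pos
  have hs' := abs_pos.2 hs0
  have hpos : 0 < (s * (z - S.pole w) : ℂ).re := (mul_pos hs' hsep).trans_le h1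
  have h3 : |(s * (z - S.pole w) : ℂ).arg| ≤ |z.im| / β.sep := by
    refine (Complex.abs_arg_le_abs_im_div_re hpos).trans ?_
    rw [Complex.im_ofReal_mul, Complex.sub_im, Complex.ofReal_im, sub_zero, abs_mul]
    calc |s| * |z.im| / (s * (z - S.pole w) : ℂ).re ≤ |s| * |z.im| / (|s| * β.sep) := by gcongr
      _ = |z.im| / β.sep := by field_simp
  have h4 : (Complex.log (S.wordDeriv w z)).im = -2 * (s * (z - S.pole w) : ℂ).arg := by
    rw [h2, show (-2 : ℂ) = ((-2 : ℝ) : ℂ) by push_cast; rfl, Complex.im_ofReal_mul,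
      Complex.log_im]
  rw [h4, abs_mul, abs_neg, abs_two]
  gcongr

open ComplexConjugate in
lemma Bounds.log_wordDeriv_conj (β : S.Bounds) {w : List (Letter m)}
    (hw : FreeGroup.IsReduced w) (h0 : w ≠ []) {b : Letter m} (hb : Follows w b) {z : ℂ}
    (hz : z ∈ S.cdisk b) :
    Complex.log (S.wordDeriv w (conj z)) = conj (Complex.log (S.wordDeriv w z)) := by
  obtain ⟨s, hs0, hs⟩ := β.exists_log_wordDeriv hw h0 hb
  obtain ⟨h1, h2⟩ := hs z hz
  have hpos : 0 < (s * (z - S.pole w) : ℂ).re :=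
    (mul_pos (abs_pos.2 hs0) β.sep_pos).trans_le h1
  rw [(hs _ (conj_mem_cdisk hz)).2, h2, map_mul, ← Complex.log_conj]
  · simpa using Or.inl (map_ofNat (starRingEnd ℂ) 2).symm
  · intro h
    have := abs_lt.1 (Complex.abs_arg_lt_pi_div_two_iff.2 (Or.inl hpos))
    linarith [Real.pi_pos]

lemma measurable_phase (u v : List (Letter m)) : Measurable (S.phase u v) := by
  unfold phase wordDeriv
  exact (measurable_deriv _).clog.sub (measurable_deriv _).clog

section Phase

variable {u v : List (Letter m)}

lemma Bounds.abs_im_phase_le (β : S.Bounds) (hu : FreeGroup.IsReduced u)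
    (hv : FreeGroup.IsReduced v) (hu0 : u ≠ []) (hv0 : v ≠ []) {b : Letter m} (hub : Follows u b)
    (hvb : Follows v b) {z : ℂ} (hz : z ∈ S.cdisk b) :
    |(S.phase u v z).im| ≤ 4 / β.sep * |z.im| := by
  rw [phase, Complex.sub_im]
  refine (abs_sub _ _).trans ?_
  have h1 := β.abs_im_log_wordDeriv_le hu hu0 hub hz
  have h2 := β.abs_im_log_wordDeriv_le hv hv0 hvb hz
  calc _ ≤ 2 * (|z.im| / β.sep) + 2 * (|z.im| / β.sep) := add_le_add h1 h2
    _ = _ := by ring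

open ComplexConjugate in
lemma Bounds.phase_conj (β : S.Bounds) (hu : FreeGroup.IsReduced u)
    (hv : FreeGroup.IsReduced v) (hu0 : u ≠ []) (hv0 : v ≠ []) {b : Letter m} (hub : Follows u b)
    (hvb : Follows v b) {z : ℂ} (hz : z ∈ S.cdisk b) :
    S.phase u v (conj z) = conj (S.phase u v z) := by
  rw [phase, phase, map_sub, β.log_wordDeriv_conj hu hu0 hub hz, β.log_wordDeriv_conj hv hv0 hvb hz]

/-- The phase is expanding at the rate of the distance between the poles: the exponential of
half a difference of values of the phase is a cross ratio of the two points and the two poles. -/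
lemma Bounds.le_norm_phase_sub (β : S.Bounds) (hu : FreeGroup.IsReduced u)
    (hv : FreeGroup.IsReduced v) (hu0 : u ≠ []) (hv0 : v ≠ []) {b : Letter m} (hub : Follows u b)
    (hvb : Follows v b) {z w : ℂ} (hz : z ∈ S.cdisk b) (hw : w ∈ S.cdisk b) :
    |S.pole u - S.pole v| * ‖z - w‖ / (4 * β.bd ^ 2) ≤ ‖S.phase u v z - S.phase u v w‖ := by
  obtain ⟨s, hs0, hs⟩ := β.exists_log_wordDeriv hu hu0 hub
  obtain ⟨s', hs0', hs'⟩ := β.exists_log_wordDeriv hv hv0 hvb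
  have hR := β.bd_pos
  have hne : ∀ {p : List (Letter m)}, FreeGroup.IsReduced p → p ≠ [] → Follows p b → ∀ {x : ℂ},
      x ∈ S.cdisk b → x - S.pole p ≠ 0 := fun hp hp0 hpb _ hx =>
    norm_pos_iff.1 (β.sep_pos.trans_le (β.sep_le_norm_sub_pole hp hp0 hpb hx))
  have hzu := hne hu hu0 hub hz
  have hzv := hne hv hv0 hvb hz
  have hwu := hne hu hu0 hub hw
  have hwv := hne hv hv0 hvb hw
  have hsc : (s : ℂ) ≠ 0 := by exact_mod_cast hs0
  have hsc' : (s' : ℂ) ≠ 0 := by exact_mod_cast hs0'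
  set X := |S.pole u - S.pole v| * ‖z - w‖ with hX
  set ξ : ℂ := (Complex.log (s * (z - S.pole u)) - Complex.log (s' * (z - S.pole v))) -
    (Complex.log (s * (w - S.pole u)) - Complex.log (s' * (w - S.pole v))) with hξ
  have hphase : S.phase u v z - S.phase u v w = -2 * ξ := by
    rw [phase, phase, (hs z hz).2, (hs' z hz).2, (hs w hw).2, (hs' w hw).2, hξ]; ring
  have hexp : Complex.exp ξ - 1 = (S.pole u - S.pole v) * (z - w) /
      ((z - S.pole v) * (w - S.pole u)) := by
    rw [hξ, Complex.exp_sub, Complex.exp_sub, Complex.exp_sub,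
      Complex.exp_log (mul_ne_zero hsc hzu), Complex.exp_log (mul_ne_zero hsc' hzv),
      Complex.exp_log (mul_ne_zero hsc hwu), Complex.exp_log (mul_ne_zero hsc' hwv)]
    field_simp
    ring
  have hlow : X / (4 * β.bd ^ 2) ≤ ‖Complex.exp ξ - 1‖ := by
    rw [hexp, norm_div, norm_mul, norm_mul, ← Complex.ofReal_sub, Complex.norm_real,
      Real.norm_eq_abs, ← hX]
    have h1 := norm_pos_iff.2 hzv
    have h2 := norm_pos_iff.2 hwu
    have h3 := mul_le_mul (β.norm_sub_pole_le hv hv0 hz) (β.norm_sub_pole_le hu hu0 hw)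
      (norm_nonneg _) (by positivity)
    refine div_le_div_of_nonneg_left (by positivity) (by positivity) (h3.trans (le_of_eq ?_))
    ring
  rw [hphase, norm_mul, norm_neg, Complex.norm_two]
  rcases le_or_gt ‖ξ‖ 1 with h | h
  · exact hlow.trans (Complex.norm_exp_sub_one_le h)
  · refine le_trans ?_ (show (1 : ℝ) ≤ 2 * ‖ξ‖ by linarith)
    rw [div_le_one (by positivity)]
    have h1 : |S.pole u - S.pole v| ≤ 2 * β.bd := (abs_sub _ _).trans
      (by linarith [β.abs_pole_le hu hu0, β.abs_pole_le hv hv0])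
    have h2 : ‖z - w‖ ≤ 2 * β.bd := (norm_sub_le _ _).trans
      (by linarith [β.norm_le hz, β.norm_le hw])
    calc X ≤ (2 * β.bd) * (2 * β.bd) := mul_le_mul h1 h2 (norm_nonneg _) (by positivity)
      _ = _ := by ring

end Phase

section ScriptD

variable (P : S.RefPoints)

lemma RefPoints.upsilon_eq {w : List (Letter m)} (hw : FreeGroup.IsReduced w) (h0 : w ≠ []) :
    P.upsilon w = (S.wordMap w 1 0 ^ 2 * ‖P.point (P.next w) - S.pole w‖ ^ 2)⁻¹ := by
  rw [RefPoints.upsilon, wordDeriv_eq hw h0 (P.follows_next w hw h0)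
    (S.disk_subset_cdisk _ (P.point_mem _)), norm_inv, norm_pow, norm_mul, Complex.norm_real,
    Real.norm_eq_abs, mul_pow, sq_abs]

lemma Bounds.upsilon_le (β : S.Bounds) {w : List (Letter m)} (hw : FreeGroup.IsReduced w)
    (h0 : w ≠ []) : P.upsilon w ≤ (S.wordMap w 1 0 ^ 2 * β.sep ^ 2)⁻¹ := by
  have hc := lower_left_ne_zero (S := S) hw h0
  have hs := β.sep_pos
  rw [P.upsilon_eq hw h0]
  gcongr
  exact β.sep_le_norm_sub_pole hw h0 (P.follows_next w hw h0)
    (S.disk_subset_cdisk _ (P.point_mem _))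

lemma Bounds.le_upsilon (β : S.Bounds) {w : List (Letter m)} (hw : FreeGroup.IsReduced w)
    (h0 : w ≠ []) : (S.wordMap w 1 0 ^ 2 * (2 * β.bd) ^ 2)⁻¹ ≤ P.upsilon w := by
  have hc := lower_left_ne_zero (S := S) hw h0
  have hmem := S.disk_subset_cdisk _ (P.point_mem (P.next w))
  have h1 := β.sep_pos.trans_le (β.sep_le_norm_sub_pole hw h0 (P.follows_next w hw h0) hmem)
  rw [P.upsilon_eq hw h0]
  gcongr
  exact β.norm_sub_pole_le hw h0 hmem

lemma Bounds.upsilon_pos (β : S.Bounds) {w : List (Letter m)} (hw : FreeGroup.IsReduced w)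
    (h0 : w ≠ []) : 0 < P.upsilon w := by
  have hc := lower_left_ne_zero (S := S) hw h0
  have := β.bd_pos
  exact lt_of_lt_of_le (by positivity) (β.le_upsilon P hw h0)

lemma lower_left_mul_inv {u v : List (Letter m)} (hu : FreeGroup.IsReduced u)
    (hv : FreeGroup.IsReduced v) (hu0 : u ≠ []) (hv0 : v ≠ []) :
    (S.wordMap u * (S.wordMap v)⁻¹) 1 0 =
      S.wordMap u 1 0 * S.wordMap v 1 0 * (S.pole u - S.pole v) := by
  rw [mul_apply_two, inv_apply_zero_zero, inv_apply_one_zero, lower_right_eq hu hu0,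
    lower_right_eq hv hv0]
  ring

variable {u v : List (Letter m)}

lemma Bounds.scriptD_pos (β : S.Bounds) (hu : FreeGroup.IsReduced u) (hv : FreeGroup.IsReduced v)
    (hu0 : u ≠ []) (hv0 : v ≠ []) (huv : u ≠ v) : 0 < P.scriptD u v :=
  Real.sqrt_pos.2 (div_pos (mul_pos (β.upsilon_pos P hu hu0) (β.upsilon_pos P hv hv0))
    (β.upsilon_pos P (isReduced_reduce _) (reduce_append_invRev_ne_nil hu hv huv)))

/-- `𝒟_{u,v}` is at most a constant times the distance between the poles of `γ_u` and `γ_v`, because the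
lower left entry of `γ_u γ_v⁻¹` is, up to sign, the product of those of `γ_u` and `γ_v` times that
distance, while `Υ_w` is comparable with the inverse square of the lower left entry of `γ_w`. -/
lemma Bounds.scriptD_le (β : S.Bounds) (hu : FreeGroup.IsReduced u) (hv : FreeGroup.IsReduced v)
    (hu0 : u ≠ []) (hv0 : v ≠ []) (huv : u ≠ v) :
    P.scriptD u v ≤ 2 * β.bd / β.sep ^ 2 * |S.pole u - S.pole v| := by
  have hR := β.bd_pos
  have hs := β.sep_pos
  have hcu := lower_left_ne_zero (S := S) hu hu0
  have hcv := lower_left_ne_zero (S := S) hv hv0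
  have hr := isReduced_reduce (u ++ FreeGroup.invRev v)
  have hr0 := reduce_append_invRev_ne_nil hu hv huv
  have h1 := β.upsilon_le P hu hu0
  have h2 := β.upsilon_le P hv hv0
  have h3 := β.le_upsilon P hr hr0
  have hc := lower_left_ne_zero (S := S) hr hr0
  rw [wordMap_reduce_append_invRev, lower_left_mul_inv hu hv hu0 hv0] at h3 hc
  have hp : S.pole u - S.pole v ≠ 0 := right_ne_zero_of_mul hc
  apply Real.sqrt_le_iff.2 ⟨by positivity, ?_⟩
  have hpos := (β.upsilon_pos P hv hv0).le
  calc P.upsilon u * P.upsilon v / P.upsilon (FreeGroup.reduce (u ++ FreeGroup.invRev v))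
      ≤ (S.wordMap u 1 0 ^ 2 * β.sep ^ 2)⁻¹ * (S.wordMap v 1 0 ^ 2 * β.sep ^ 2)⁻¹ /
        ((S.wordMap u 1 0 * S.wordMap v 1 0 * (S.pole u - S.pole v)) ^ 2 *
          (2 * β.bd) ^ 2)⁻¹ := by gcongr
    _ = (2 * β.bd / β.sep ^ 2 * |S.pole u - S.pole v|) ^ 2 := by
        rw [mul_pow (2 * β.bd / β.sep ^ 2), sq_abs]
        field_simp

lemma Bounds.scriptD_le_const (β : S.Bounds) (hu : FreeGroup.IsReduced u)
    (hv : FreeGroup.IsReduced v) (hu0 : u ≠ []) (hv0 : v ≠ []) (huv : u ≠ v) :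
    P.scriptD u v ≤ 4 * β.bd ^ 2 / β.sep ^ 2 := by
  have hR := β.bd_pos
  have hs := β.sep_pos
  refine (β.scriptD_le P hu hv hu0 hv0 huv).trans ?_
  have h1 : |S.pole u - S.pole v| ≤ 2 * β.bd := (abs_sub _ _).trans
    (by linarith [β.abs_pole_le hu hu0, β.abs_pole_le hv hv0])
  calc 2 * β.bd / β.sep ^ 2 * |S.pole u - S.pole v| ≤ 2 * β.bd / β.sep ^ 2 * (2 * β.bd) := by
        gcongr
    _ = _ := by ring

open ComplexConjugate in
lemma Bounds.le_norm_phase_sub_conj (β : S.Bounds) (hu : FreeGroup.IsReduced u)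
    (hv : FreeGroup.IsReduced v) (hu0 : u ≠ []) (hv0 : v ≠ []) (huv : u ≠ v) {b : Letter m}
    (hub : Follows u b) (hvb : Follows v b) {z w : ℂ} (hz : z ∈ S.cdisk b) (hw : w ∈ S.cdisk b) :
    β.sep ^ 2 / (8 * β.bd ^ 3) * P.scriptD u v * ‖z - conj w‖ ≤
      ‖S.phase u v z - conj (S.phase u v w)‖ := by
  have hR := β.bd_pos
  have hs := β.sep_pos
  rw [← β.phase_conj hu hv hu0 hv0 hub hvb hw]
  refine le_trans ?_ (β.le_norm_phase_sub hu hv hu0 hv0 hub hvb hz (conj_mem_cdisk hw))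
  have h1 := β.scriptD_le P hu hv hu0 hv0 huv
  calc β.sep ^ 2 / (8 * β.bd ^ 3) * P.scriptD u v * ‖z - conj w‖
      ≤ β.sep ^ 2 / (8 * β.bd ^ 3) * (2 * β.bd / β.sep ^ 2 * |S.pole u - S.pole v|) *
        ‖z - conj w‖ := by gcongr
    _ = _ := by field_simp; ring

end ScriptD

end Data

end Schottky

/-! ### The energy of the phase -/

section StripEnergy

open MeasureTheory

lemma setLIntegral_Ioc_enorm_rpow {s B : ℝ} (hs : s < 1) (hB : 0 ≤ B) :
    ∫⁻ y in Set.Ioc 0 B, ‖y‖ₑ ^ (-s) = ENNReal.ofReal (B ^ (1 - s) / (1 - s)) := by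
  have hint : IntegrableOn (fun y : ℝ => y ^ (-s)) (Set.Ioc 0 B) :=
    (intervalIntegrable_iff_integrableOn_Ioc_of_le hB).1
      (intervalIntegral.intervalIntegrable_rpow' (by linarith))
  have h1 : ∫⁻ y in Set.Ioc 0 B, ‖y‖ₑ ^ (-s) = ∫⁻ y in Set.Ioc 0 B, ENNReal.ofReal (y ^ (-s)) :=
    setLIntegral_congr_fun measurableSet_Ioc fun y hy => by
      rw [← ofReal_norm, Real.norm_of_nonneg hy.1.le, ENNReal.ofReal_rpow_of_pos hy.1]
  rw [h1, ← ofReal_integral_eq_lintegral_ofReal hint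
    ((ae_restrict_mem measurableSet_Ioc).mono fun y hy => Real.rpow_nonneg hy.1.le _),
    ← intervalIntegral.integral_of_le hB, integral_rpow (Or.inl (by linarith)),
    Real.zero_rpow (by linarith), sub_zero]
  congr 2 <;> ring_nf

lemma setLIntegral_Icc_enorm_rpow_le {s B : ℝ} (hs : s < 1) (hB : 0 ≤ B) :
    ∫⁻ y in Set.Icc (-B) B, ‖y‖ₑ ^ (-s) ≤ ENNReal.ofReal (2 * (B ^ (1 - s) / (1 - s))) := by
  set g : ℝ → ENNReal := (Set.Ioc 0 B).indicator fun y => ‖y‖ₑ ^ (-s) with hg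
  have hgm : Measurable g := by
    refine Measurable.indicator ?_ measurableSet_Ioc
    fun_prop
  have hgint : ∫⁻ y, g y = ENNReal.ofReal (B ^ (1 - s) / (1 - s)) := by
    rw [hg, lintegral_indicator measurableSet_Ioc, setLIntegral_Ioc_enorm_rpow hs hB]
  have hnn : 0 ≤ B ^ (1 - s) / (1 - s) := div_nonneg (Real.rpow_nonneg hB _) (by linarith)
  calc ∫⁻ y in Set.Icc (-B) B, ‖y‖ₑ ^ (-s)
      = ∫⁻ y, (Set.Icc (-B) B).indicator (fun y => ‖y‖ₑ ^ (-s)) y :=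
        (lintegral_indicator measurableSet_Icc _).symm
    _ ≤ ∫⁻ y, (g y + g (-y)) := by
        refine lintegral_mono_ae ?_
        filter_upwards [compl_mem_ae_iff.2 (measure_singleton (0 : ℝ))] with y hy
        refine Set.indicator_apply_le' (fun hy' => ?_) (fun _ => zero_le)
        rcases lt_or_gt_of_ne (show y ≠ 0 from hy) with h | h
        · have : -y ∈ Set.Ioc 0 B := ⟨by linarith, by linarith [hy'.1]⟩
          refine le_trans ?_ le_add_self
          rw [hg, Set.indicator_of_mem this, enorm_neg]
        · have : y ∈ Set.Ioc 0 B := ⟨h, hy'.2⟩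
          refine le_trans ?_ le_self_add
          rw [hg, Set.indicator_of_mem this]
    _ = _ := by
        rw [lintegral_add_left hgm, lintegral_neg_eq_self, hgint, ← ENNReal.ofReal_add hnn hnn,
          two_mul]

lemma setLIntegral_Icc_enorm_sub_rpow_le {s B x₀ : ℝ} (hs : s < 1) (hB : 0 ≤ B)
    (hx₀ : |x₀| ≤ B) :
    ∫⁻ y in Set.Icc (-B) B, ‖y - x₀‖ₑ ^ (-s) ≤
      ENNReal.ofReal (2 * ((2 * B) ^ (1 - s) / (1 - s))) := by
  refine le_trans ?_ (setLIntegral_Icc_enorm_rpow_le hs (by linarith : (0 : ℝ) ≤ 2 * B))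
  rw [← lintegral_indicator measurableSet_Icc, ← lintegral_indicator measurableSet_Icc,
    ← lintegral_sub_right_eq_self (μ := volume)
      ((Set.Icc (-(2 * B)) (2 * B)).indicator fun y : ℝ => ‖y‖ₑ ^ (-s)) x₀]
  refine lintegral_mono fun y => ?_
  have hx := abs_le.1 hx₀
  refine Set.indicator_apply_le' (fun hy => ?_) (fun _ => zero_le)
  rw [Set.indicator_of_mem (show y - x₀ ∈ Set.Icc (-(2 * B)) (2 * B) from
    ⟨by linarith [hy.1], by linarith [hy.2]⟩)]

lemma Complex.enorm_inv_le_re_im {τ : ℝ} (hτ0 : 0 < τ) (hτ1 : τ < 1) (z : ℂ) :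
    ‖z‖ₑ⁻¹ ≤ ‖z.re‖ₑ ^ (-(1 - τ)) * ‖z.im‖ₑ ^ (-τ) := by
  rw [ENNReal.rpow_neg, ENNReal.rpow_neg, ← ENNReal.mul_inv
    (Or.inr (ENNReal.rpow_ne_top_of_nonneg hτ0.le enorm_ne_top))
    (Or.inl (ENNReal.rpow_ne_top_of_nonneg (by linarith) enorm_ne_top)), ENNReal.inv_le_inv]
  have h1 : ‖z.re‖ₑ ≤ ‖z‖ₑ := enorm_le_iff_norm_le.2 (Complex.abs_re_le_norm z)
  have h2 : ‖z.im‖ₑ ≤ ‖z‖ₑ := enorm_le_iff_norm_le.2 (Complex.abs_im_le_norm z)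
  calc ‖z.re‖ₑ ^ (1 - τ) * ‖z.im‖ₑ ^ τ ≤ ‖z‖ₑ ^ (1 - τ) * ‖z‖ₑ ^ τ := by
        gcongr
    _ = ‖z‖ₑ := by
        rw [← ENNReal.rpow_add_of_nonneg _ _ (by linarith) hτ0.le, sub_add_cancel,
          ENNReal.rpow_one]

open ComplexConjugate in
/-- The energy of a thin strip: the kernel `|z - w̄|⁻¹` is bounded by a product of powers of
`|Re z - Re w|` and `|Im z + Im w|`, and the double integral factors. -/
lemma setLIntegral_strip_le {τ R h : ℝ} (hτ0 : 0 < τ) (hτ1 : τ < 1) (hR : 0 ≤ R) (hh : 0 ≤ h)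
    {z : ℂ} (hzr : |z.re| ≤ R) (hzi : |z.im| ≤ h) {Ω : Set ℂ} (hΩ : MeasurableSet Ω)
    (hΩr : ∀ w ∈ Ω, |w.re| ≤ R) (hΩi : ∀ w ∈ Ω, |w.im| ≤ h) :
    ∫⁻ w in Ω, ‖z - conj w‖ₑ⁻¹ ≤
      ENNReal.ofReal (2 * ((2 * R) ^ τ / τ) * (2 * ((2 * h) ^ (1 - τ) / (1 - τ)))) := by
  set F : ℝ → ENNReal := (Set.Icc (-R) R).indicator fun x => ‖x - z.re‖ₑ ^ (-(1 - τ)) with hF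
  set G : ℝ → ENNReal := (Set.Icc (-h) h).indicator fun y => ‖y - -z.im‖ₑ ^ (-τ) with hG
  have hFm : Measurable F := by
    refine Measurable.indicator ?_ measurableSet_Icc
    fun_prop
  have hGm : Measurable G := by
    refine Measurable.indicator ?_ measurableSet_Icc
    fun_prop
  have hFi : ∫⁻ x, F x ≤ ENNReal.ofReal (2 * ((2 * R) ^ τ / τ)) := by
    rw [hF, lintegral_indicator measurableSet_Icc]
    have := setLIntegral_Icc_enorm_sub_rpow_le (s := 1 - τ) (by linarith) hR hzr
    rwa [sub_sub_cancel] at this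
  have hGi : ∫⁻ y, G y ≤ ENNReal.ofReal (2 * ((2 * h) ^ (1 - τ) / (1 - τ))) := by
    rw [hG, lintegral_indicator measurableSet_Icc]
    exact setLIntegral_Icc_enorm_sub_rpow_le hτ1 hh (by rwa [abs_neg])
  calc ∫⁻ w in Ω, ‖z - conj w‖ₑ⁻¹ ≤ ∫⁻ w in Ω, F w.re * G w.im := by
        refine setLIntegral_mono' hΩ fun w hw => ?_
        rw [hF, hG, Set.indicator_of_mem (Set.mem_Icc.2 (abs_le.1 (hΩr w hw))),
          Set.indicator_of_mem (Set.mem_Icc.2 (abs_le.1 (hΩi w hw)))]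
        refine (Complex.enorm_inv_le_re_im hτ0 hτ1 _).trans (le_of_eq ?_)
        rw [← enorm_neg (w.re - z.re)]
        simp only [Complex.sub_re, Complex.sub_im, Complex.conj_re, Complex.conj_im, neg_sub,
          sub_neg_eq_add]
        rw [add_comm z.im]
    _ ≤ ∫⁻ w : ℂ, F w.re * G w.im := setLIntegral_le_lintegral _ _
    _ = ∫⁻ p : ℝ × ℝ, F p.1 * G p.2 :=
        Complex.volume_preserving_equiv_real_prod.lintegral_comp
          (f := fun p : ℝ × ℝ => F p.1 * G p.2)
          ((hFm.comp measurable_fst).mul (hGm.comp measurable_snd))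
    _ = (∫⁻ x, F x) * ∫⁻ y, G y := lintegral_prod_mul hFm.aemeasurable hGm.aemeasurable
    _ ≤ _ := by
        rw [ENNReal.ofReal_mul (by positivity)]
        exact mul_le_mul' hFi hGi

end StripEnergy

namespace Schottky

variable {m : ℕ}

namespace Data

open MeasureTheory

variable {S : Data m}

lemma measurableSet_omega (b : Letter m) (h : ℝ) : MeasurableSet (S.omega b h) :=
  ((Metric.isOpen_ball.add_left).inter Metric.isOpen_ball).measurableSet

lemma omega_subset_disk (b : Letter m) (h : ℝ) : S.omega b h ⊆ S.disk b := Set.inter_subset_right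

lemma abs_im_le_of_mem_omega {b : Letter m} {h : ℝ} {z : ℂ} (hz : z ∈ S.omega b h) :
    |z.im| ≤ h := by
  obtain ⟨p, hp, y, hy, rfl⟩ := Set.mem_add.1 hz.1
  rw [Metric.mem_ball, Complex.dist_eq, sub_zero] at hy
  rw [Complex.add_im, im_eq_zero_of_mem_limitSet hp, zero_add]
  exact (Complex.abs_im_le_norm y).trans hy.le

open ComplexConjugate in
/-- The energy of the phase is at most that of the kernel `|z - w̄|⁻¹` on a strip of height `h`, divided
by the expansion rate of the phase. -/
lemma Bounds.energy_le (β : S.Bounds) (P : S.RefPoints) {u v : List (Letter m)}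
    (hu : FreeGroup.IsReduced u) (hv : FreeGroup.IsReduced v) (hu0 : u ≠ []) (hv0 : v ≠ [])
    (huv : u ≠ v) {b : Letter m} (hub : Follows u b) (hvb : Follows v b) {τ h : ℝ} (hτ0 : 0 < τ)
    (hτ1 : τ < 1) (hh : 0 ≤ h) {z : ℂ} (hz : z ∈ S.omega b h) :
    ∫⁻ w in S.omega b h, ‖S.phase u v z - conj (S.phase u v w)‖ₑ⁻¹ ≤
      ENNReal.ofReal ((β.sep ^ 2 / (8 * β.bd ^ 3) * P.scriptD u v)⁻¹ *
        (2 * ((2 * β.bd) ^ τ / τ) * (2 * ((2 * h) ^ (1 - τ) / (1 - τ))))) := by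
  have hR := β.bd_pos
  have hs := β.sep_pos
  have hD := β.scriptD_pos P hu hv hu0 hv0 huv
  have hmem : ∀ w ∈ S.omega b h, w ∈ S.cdisk b := fun w hw =>
    S.disk_subset_cdisk b (omega_subset_disk b h hw)
  have hre : ∀ w ∈ S.omega b h, |w.re| ≤ β.bd := fun w hw =>
    (Complex.abs_re_le_norm w).trans (β.norm_le (hmem w hw))
  set k := β.sep ^ 2 / (8 * β.bd ^ 3) * P.scriptD u v with hk
  have hk0 : 0 < k := by positivity
  calc ∫⁻ w in S.omega b h, ‖S.phase u v z - conj (S.phase u v w)‖ₑ⁻¹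
      ≤ ∫⁻ w in S.omega b h, ENNReal.ofReal k⁻¹ * ‖z - conj w‖ₑ⁻¹ := by
        refine setLIntegral_mono' (measurableSet_omega b h) fun w hw => ?_
        rw [ENNReal.ofReal_inv_of_pos hk0, ← ENNReal.mul_inv (by simp [hk0]) (by simp),
          ENNReal.inv_le_inv, ← ofReal_norm, ← ofReal_norm, ← ENNReal.ofReal_mul hk0.le]
        exact ENNReal.ofReal_le_ofReal
          (β.le_norm_phase_sub_conj P hu hv hu0 hv0 huv hub hvb (hmem z hz) (hmem w hw))
    _ = ENNReal.ofReal k⁻¹ * ∫⁻ w in S.omega b h, ‖z - conj w‖ₑ⁻¹ :=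
        lintegral_const_mul' _ _ ENNReal.ofReal_ne_top
    _ ≤ _ := by
        rw [ENNReal.ofReal_mul (by positivity)]
        gcongr
        exact setLIntegral_strip_le hτ0 hτ1 hR.le hh (hre z hz) (abs_im_le_of_mem_omega hz)
          (measurableSet_omega b h) hre fun w => abs_im_le_of_mem_omega

end Data

end Schottky

/-! ### The averaged bound -/

namespace Schottky

variable {m : ℕ}

namespace Data

open MeasureTheory

variable {S : Data m}

open ComplexConjugate in
/-- The averaged oscillatory integral in terms of the area of `Ω_b(h)` and of the energy of the
phase. -/
lemma Bounds.average_le (β : S.Bounds) {u v : List (Letter m)} (hu : FreeGroup.IsReduced u)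
    (hv : FreeGroup.IsReduced v) (hu0 : u ≠ []) (hv0 : v ≠ []) {b : Letter m}
    (hub : Follows u b) (hvb : Follows v b) {h T J A : ℝ} (hh : 0 < h) (hT : 0 < T)
    (hJ0 : 0 ≤ J) (hA0 : 0 ≤ A)
    (hJ : ∀ z ∈ S.omega b h, ∫⁻ w in S.omega b h, ‖S.phase u v z - conj (S.phase u v w)‖ₑ⁻¹ ≤
      ENNReal.ofReal J)
    (hA : volume (S.omega b h) ≤ ENNReal.ofReal A) {f : ℂ → ℂ}
    (hf : AEMeasurable f (volume.restrict (S.omega b h))) {B : ℝ} (hB0 : 0 ≤ B)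
    (hB : ∀ z ∈ S.omega b h, ‖f z‖ ≤ B) :
    (∀ t : ℝ, IntegrableOn (fun z => Complex.exp (Complex.I * t * S.phase u v z) * f z)
      (S.omega b h)) ∧
    IntervalIntegrable (fun t : ℝ => ‖∫ z in S.omega b h,
      Complex.exp (Complex.I * t * S.phase u v z) * f z‖) volume 0 T ∧
    ∫ t in (0 : ℝ)..T, ‖∫ z in S.omega b h,
      Complex.exp (Complex.I * t * S.phase u v z) * f z‖ ≤
      Real.sqrt (T * (2 * B ^ 2 * Real.exp (2 * (4 / β.sep * h) * T) * A * J)) := by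
  set Ω := S.omega b h with hΩ
  have hΩm : MeasurableSet Ω := measurableSet_omega b h
  have hs := β.sep_pos
  set μ := (volume : Measure ℂ).restrict Ω with hμ
  have hfin : IsFiniteMeasure μ := ⟨by
    rw [hμ, Measure.restrict_apply_univ]; exact hA.trans_lt ENNReal.ofReal_lt_top⟩
  -- Pass to representatives that are measurable and bounded everywhere.
  set f₀ : ℂ → ℂ := {z | ‖hf.mk f z‖ ≤ B}.indicator (hf.mk f) with hf₀
  have hf₀m : Measurable f₀ := hf.measurable_mk.indicator
    (measurableSet_le hf.measurable_mk.norm measurable_const)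
  have hf₀B : ∀ z, ‖f₀ z‖ ≤ B := by
    intro z
    by_cases hz : ‖hf.mk f z‖ ≤ B
    · rw [hf₀, Set.indicator_of_mem (show z ∈ {z | ‖hf.mk f z‖ ≤ B} from hz)]; exact hz
    · rw [hf₀, Set.indicator_of_notMem (show z ∉ {z | ‖hf.mk f z‖ ≤ B} from hz), norm_zero]
      exact hB0
  set Ψ : ℂ → ℂ := Ω.indicator (S.phase u v) with hΨ
  have hΨm : Measurable Ψ := (measurable_phase u v).indicator hΩm
  have hΨi : ∀ z, |(Ψ z).im| ≤ 4 / β.sep * h := by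
    intro z
    by_cases hz : z ∈ Ω
    · rw [hΨ, Set.indicator_of_mem hz]
      refine (β.abs_im_phase_le hu hv hu0 hv0 hub hvb
        (S.disk_subset_cdisk b (omega_subset_disk b h hz))).trans ?_
      gcongr
      exact abs_im_le_of_mem_omega hz
    · rw [hΨ, Set.indicator_of_notMem hz]
      simp only [Complex.zero_im, abs_zero]
      positivity
  have hmem : ∀ᵐ z ∂μ, z ∈ Ω := ae_restrict_mem hΩm
  have hcongr : ∀ t : ℝ, (fun z => Complex.exp (Complex.I * t * Ψ z) * f₀ z) =ᵐ[μ]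
      fun z => Complex.exp (Complex.I * t * S.phase u v z) * f z := by
    intro t
    filter_upwards [hmem, hf.ae_eq_mk] with z hz hfz
    have h1 : z ∈ {z | ‖hf.mk f z‖ ≤ B} := by
      change ‖hf.mk f z‖ ≤ B
      rw [← hfz]; exact hB z hz
    rw [hΨ, hf₀, Set.indicator_of_mem hz, Set.indicator_of_mem h1, hfz]
  have hJ' : ∀ᵐ z ∂μ, ∫⁻ w, ‖Ψ z - conj (Ψ w)‖ₑ⁻¹ ∂μ ≤ ENNReal.ofReal J := by
    filter_upwards [hmem] with z hz
    refine le_trans (le_of_eq ?_) (hJ z hz)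
    refine lintegral_congr_ae ?_
    filter_upwards [hmem] with w hw
    rw [hΨ, Set.indicator_of_mem hz, Set.indicator_of_mem hw]
  obtain ⟨h1, h2, h3⟩ := integral_norm_oscillatory_le μ hΨm hf₀m hf₀B hB0 (by positivity) hΨi hT
    hJ0 hJ'
  have hG : ∀ t : ℝ, ∫ z, Complex.exp (Complex.I * t * Ψ z) * f₀ z ∂μ =
      ∫ z in Ω, Complex.exp (Complex.I * t * S.phase u v z) * f z := fun t =>
    integral_congr_ae (hcongr t)
  simp_rw [hG] at h2 h3
  refine ⟨fun t => (h1 t).congr (hcongr t), h2, h3.trans (Real.sqrt_le_sqrt ?_)⟩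
  have h4 : μ.real Set.univ ≤ A := by
    rw [hμ, measureReal_restrict_apply_univ, Measure.real]
    exact ENNReal.toReal_le_of_le_ofReal hA0 hA
  gcongr

/-- The arithmetic of the exponents. The surplus of the energy bound is a power of `hT`, which the
exponential absorbs. -/
lemma sqrt_energy_le {δ ε τ h T c B k D Dmax K₁ K₂ : ℝ} (hτ : τ ≤ 2 * ε) (hτ0 : 0 < τ)
    (hτ1 : τ < 1) (hh : 0 < h) (hT : 1 ≤ T) (hB : 0 ≤ B) (hk : 0 < k) (hD : 0 < D)
    (hDmax : D ≤ Dmax) (hK₁ : 0 < K₁) (hK₂ : 0 < K₂) :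
    1 / T * Real.sqrt (T * (2 * B ^ 2 * Real.exp (2 * (c * h) * T) * (K₁ * h ^ (2 - δ)) *
      ((k * D)⁻¹ * (K₂ * h ^ (1 - τ))))) ≤
    Real.sqrt (2 * K₁ * K₂ * Dmax / k) * h ^ (1 - δ / 2) * D⁻¹ * T ^ (-1 + ε) *
      Real.exp ((c + 1) * h * T) * B := by
  have hT0 : 0 < T := by linarith
  have hDm0 : 0 < Dmax := hD.trans_le hDmax
  rw [one_div, inv_mul_le_iff₀ hT0]
  apply Real.sqrt_le_iff.2 ⟨by positivity, ?_⟩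
  have e1 : (h ^ (1 - δ / 2)) ^ 2 = h ^ (2 - δ) := by
    rw [← Real.rpow_natCast, ← Real.rpow_mul hh.le]; congr 1; push_cast; ring
  have e2 : T * T ^ (-1 + ε) = T ^ ε := by
    rw [Real.rpow_add hT0, Real.rpow_neg_one, mul_inv_cancel_left₀ hT0.ne']
  have e3 : (T ^ ε) ^ 2 = T ^ (2 * ε) := by
    rw [← Real.rpow_natCast, ← Real.rpow_mul hT0.le]; congr 1; push_cast; ring
  have e4 : Real.exp ((c + 1) * h * T) ^ 2 =
      Real.exp (2 * (c * h) * T) * Real.exp (2 * (h * T)) := by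
    rw [sq, ← Real.exp_add, ← Real.exp_add]; congr 1; ring
  have key : T * h ^ (1 - τ) ≤ T ^ (2 * ε) * Real.exp (2 * (h * T)) := by
    have h1 : T * h ^ (1 - τ) = T ^ τ * (h * T) ^ (1 - τ) := by
      rw [Real.mul_rpow hh.le hT0.le, Real.rpow_sub hT0, Real.rpow_one]
      field_simp
    have h2 : (h * T) ^ (1 - τ) ≤ Real.exp (2 * (h * T)) := by
      have hx : 0 < h * T := by positivity
      calc (h * T) ^ (1 - τ) ≤ (1 + h * T) ^ (1 - τ) :=
            Real.rpow_le_rpow hx.le (by linarith) (by linarith)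
        _ ≤ (1 + h * T) ^ (1 : ℝ) :=
            Real.rpow_le_rpow_of_exponent_le (by linarith) (by linarith)
        _ = h * T + 1 := by rw [Real.rpow_one, add_comm]
        _ ≤ Real.exp (h * T) := Real.add_one_le_exp _
        _ ≤ _ := Real.exp_le_exp.2 (by linarith)
    rw [h1]
    have h3 : T ^ τ ≤ T ^ (2 * ε) := Real.rpow_le_rpow_of_exponent_le hT hτ
    gcongr
  have hDD : D⁻¹ ≤ Dmax * D⁻¹ ^ 2 := by
    rw [inv_pow, ← div_eq_mul_inv, inv_eq_one_div, div_le_div_iff₀ hD (by positivity)]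
    nlinarith
  calc T * (2 * B ^ 2 * Real.exp (2 * (c * h) * T) * (K₁ * h ^ (2 - δ)) *
      ((k * D)⁻¹ * (K₂ * h ^ (1 - τ))))
      = (2 * K₁ * K₂ / k) * B ^ 2 * h ^ (2 - δ) * Real.exp (2 * (c * h) * T) *
        (T * h ^ (1 - τ)) * D⁻¹ := by rw [mul_inv]; ring
    _ ≤ (2 * K₁ * K₂ / k) * B ^ 2 * h ^ (2 - δ) * Real.exp (2 * (c * h) * T) *
        (T ^ (2 * ε) * Real.exp (2 * (h * T))) * (Dmax * D⁻¹ ^ 2) := by gcongr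
    _ = (2 * K₁ * K₂ * Dmax / k) * (h ^ (2 - δ)) * D⁻¹ ^ 2 * T ^ (2 * ε) *
        (Real.exp (2 * (c * h) * T) * Real.exp (2 * (h * T))) * B ^ 2 := by ring
    _ = (T * (Real.sqrt (2 * K₁ * K₂ * Dmax / k) * h ^ (1 - δ / 2) * D⁻¹ * T ^ (-1 + ε) *
        Real.exp ((c + 1) * h * T) * B)) ^ 2 := by
      rw [← e1, ← e3, ← e4, ← e2,
        ← Real.sq_sqrt (show 0 ≤ 2 * K₁ * K₂ * Dmax / k by positivity)]
      rw [Real.sqrt_sq (Real.sqrt_nonneg _)]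
      ring

end Data

end Schottky

theorem mainTheorem3 {m : ℕ} (hm : 2 ≤ m) (S : Schottky.Data m) :
    ∃ C T₀ h₀ : ℝ, 0 < C ∧ 0 < T₀ ∧ 0 < h₀ ∧ ∀ ε : ℝ, 0 < ε → ∃ K : ℝ, 0 < K ∧
      ∀ (P : S.RefPoints) (b : Schottky.Letter m) (u v : List (Schottky.Letter m)),
        FreeGroup.IsReduced u → FreeGroup.IsReduced v → u ≠ [] → v ≠ [] →
        Schottky.Follows u b → Schottky.Follows v b → u ≠ v →
        ∀ T : ℝ, T₀ ≤ T → ∀ h : ℝ, 0 < h → h < h₀ →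
        ∀ f : ℂ → ℂ, AEMeasurable f (MeasureTheory.volume.restrict S.disks) →
          BddAbove ((fun z => ‖f z‖) '' S.disk b) →
          (∀ t : ℝ, MeasureTheory.IntegrableOn
            (fun z => Complex.exp (Complex.I * t * S.phase u v z) * f z) (S.omega b h)) ∧
          IntervalIntegrable
            (fun t : ℝ => ‖∫ z in S.omega b h,
              Complex.exp (Complex.I * t * S.phase u v z) * f z‖) MeasureTheory.volume 0 T ∧
          1 / T * (∫ t in (0 : ℝ)..T, ‖∫ z in S.omega b h,
              Complex.exp (Complex.I * t * S.phase u v z) * f z‖) ≤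
            K * h ^ (1 - S.delta / 2) * (P.scriptD u v)⁻¹ * T ^ (-1 + ε) *
              Real.exp (C * h * T) * sSup ((fun z => ‖f z‖) '' S.disk b) := by
  obtain ⟨β⟩ := S.nonempty_bounds
  have hs := β.sep_pos
  have hR := β.bd_pos
  obtain ⟨K₁, h₁, hK₁, hh₁, hvol⟩ := Schottky.Data.exists_volume_omega_le hm S
  refine ⟨4 / β.sep + 1, 1, h₁, by positivity, one_pos, hh₁, fun ε hε => ?_⟩
  set τ := min ε (1 / 2) with hτ
  have hτ0 : 0 < τ := lt_min hε (by norm_num)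
  have hτ1 : τ < 1 := (min_le_right _ _).trans_lt (by norm_num)
  have hτε : τ ≤ 2 * ε := (min_le_left _ _).trans (by linarith)
  have hτ1' : 0 < 1 - τ := by linarith
  set K₂ := 2 * ((2 * β.bd) ^ τ / τ) * (2 * (2 ^ (1 - τ) / (1 - τ))) with hK₂
  have hK₂0 : 0 < K₂ := by positivity
  set k := β.sep ^ 2 / (8 * β.bd ^ 3) with hk
  have hk0 : 0 < k := by positivity
  set Dmax := 4 * β.bd ^ 2 / β.sep ^ 2 with hDmax
  have hDmax0 : 0 < Dmax := by positivity
  refine ⟨Real.sqrt (2 * K₁ * K₂ * Dmax / k), by positivity, ?_⟩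
  intro P b u v hu hv hu0 hv0 hub hvb huv T hT h hh hlt f hf hfb
  have hT0 : 0 < T := by linarith
  have hD := β.scriptD_pos P hu hv hu0 hv0 huv
  have hDle := β.scriptD_le_const P hu hv hu0 hv0 huv
  set B := sSup ((fun z => ‖f z‖) '' S.disk b) with hB
  have hfB : ∀ z ∈ S.disk b, ‖f z‖ ≤ B := fun z hz => le_csSup hfb ⟨z, hz, rfl⟩
  have hB0 : 0 ≤ B := Real.sSup_nonneg (by rintro _ ⟨z, -, rfl⟩; exact norm_nonneg _)
  have hsub : S.omega b h ⊆ S.disks :=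
    (Schottky.Data.omega_subset_disk b h).trans (Set.subset_iUnion S.disk b)
  have hJ : ∀ z ∈ S.omega b h, _ := fun z hz =>
    β.energy_le P hu hv hu0 hv0 huv hub hvb hτ0 hτ1 hh.le hz
  have hJeq : (k * P.scriptD u v)⁻¹ *
      (2 * ((2 * β.bd) ^ τ / τ) * (2 * ((2 * h) ^ (1 - τ) / (1 - τ)))) =
      (k * P.scriptD u v)⁻¹ * (K₂ * h ^ (1 - τ)) := by
    rw [hK₂, Real.mul_rpow zero_le_two hh.le]; ring
  simp only [← hk] at hJ
  rw [hJeq] at hJ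
  obtain ⟨h1, h2, h3⟩ := β.average_le hu hv hu0 hv0 hub hvb hh hT0 (by positivity) (by positivity)
    hJ (hvol h hh hlt b) (hf.mono_set hsub) hB0
    (fun z hz => hfB z (Schottky.Data.omega_subset_disk b h hz))
  refine ⟨h1, h2, le_trans (mul_le_mul_of_nonneg_left h3 (by positivity)) ?_⟩
  exact Schottky.Data.sqrt_energy_le hτε hτ0 hτ1 hh hT hB0 hk0 hD hDle hK₁ hK₂0
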